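/- Let $d\ge 1$, $1\le p<\infty$, and let $\Omega\subset\mathbb{R}^d$ be open, bounded, connected and polyhedral (its boundary is a finite union of parts of hyperplanes). A discretisation $\mathcal D=(\mathcal M,\mathcal E,\mathcal P)$ of $\Omega$ consists of the following. (1) $\mathcal M$ is a finite family of nonempty connected open disjoint subsets of $\Omega$ (the control volumes) with $\overline\Omega=\bigcup_{K\in\mathcal M}\overline K$. (2) $\mathcal E$ is a finite family of disjoint subsets of $\overline\Omega$ (the edges). Each $\sigma\in\mathcal E$ is a nonempty open subset of a hyperplane, its $(d-1)$-dimensional Lebesgue measure $|\sigma|$ is positive, and $\overline\sigma\setminus\sigma$ has $(d-1)$-dimensional measure zero. Each $K\in\mathcal M$ comes with a subset $\mathcal E_K\subset\mathcal E$ such that $\partial K=\bigcup_{\sigma\in\mathcal E_K}\overline\sigma$. With $\mathcal M_\sigma=\{K\in\mathcal M:\sigma\in\mathcal E_K\}$, for every $\sigma\in\mathcal E$ either $\mathcal M_\sigma$ has exactly one element and $\sigma\subset\partial\Omega$, or $\mathcal M_\sigma$ has exactly two elements. (3) $\mathcal P=(x_K)_{K\in\mathcal M}$ is a family of points with $x_K\in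 K$, such that $K$ is star-shaped with respect to $x_K$ and, for every $\sigma\in\mathcal E_K$, the Euclidean distance $d_{K,\sigma}$ from $x_K$ to the hyperplane including $\sigma$ is positive. Let $H_{\mathcal D}(\Omega)$ be the set of functions $u$ on $\Omega$ that are constant on each $K\in\mathcal M$, with value $u_K$ (functions being identified when they agree almost everywhere). If $\mathcal M_\sigma=\{K,L\}$ with $K\neq L$, put $D_\sigma u=|u_K-u_L|$ and $d_\sigma=d_{K,\sigma}+d_{L,\sigma}$; if $\mathcal M_\sigma=\{K\}$, put $D_\sigma u=|u_K|$ and $d_\sigma=d_{K,\sigma}$. Define $$\|u\|_{1,p,\mathcal M}=\Big(\sum_{K\in\mathcal M}\sum_{\sigma\in\mathcal E_K}|\sigma|\,d_{K,\sigma}\Big(\frac{D_\sigma u}{d_\sigma}\Big)^p\Big)^{1/p}.$$ Let $F$ be a family of discretisations of $\Omega$, and let $\eta>0$ be such that, for all $\mathcal D\in F$, $\eta\le d_{K,\sigma}/d_{L,\sigma}\le 1/\eta$ for every edge $\sigma$ of $\mathcal D$ with $\mathcal M_\sigma=\{K,L\}$, $K\ne L$. For each $\mathcal D\in F$ let $u_{\mathcal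 D}\in H_{\mathcal D}(\Omega)$, and assume that there is $C\in\mathbb{R}$ with $\|u_{\mathcal D}\|_{1,p,\mathcal M}\le C$ for all $\mathcal D\in F$. Then the family $(u_{\mathcal D})_{\mathcal D\in F}$ is relatively compact in $L^p(\Omega)$, and also in $L^p(\mathbb{R}^d)$ when each $u_{\mathcal D}$ is extended by $0$ outside $\Omega$. -/

import Mathlib

open MeasureTheory
open scoped ENNReal

/-- A subset of `ℝ^d` is polyhedral when its boundary is a finite union of parts of hyperplanes,
i.e. when its boundary is contained in the union of finitely many hyperplanes. -/
def IsPolyhedral {d : ℕ} (Ω : Set (EuclideanSpace ℝ (Fin d))) : Prop :=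
  ∃ A : Finset (AffineSubspace ℝ (EuclideanSpace ℝ (Fin d))),
    (∀ H ∈ A, Module.finrank ℝ H.direction + 1 = d) ∧
      frontier Ω ⊆ ⋃ H ∈ A, (H : Set (EuclideanSpace ℝ (Fin d)))

/-- The `(d-1)`-dimensional Lebesgue measure of a subset of a hyperplane of `ℝ^d`
(the `(d-1)`-dimensional Hausdorff measure, normalised so as to agree with Lebesgue measure
on `(d-1)`-dimensional Euclidean spaces). -/
noncomputable def surfaceMeasure (d : ℕ) : Measure (EuclideanSpace ℝ (Fin d)) :=
  Measure.euclideanHausdorffMeasure (d - 1)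

/-- A space discretisation `(M, E, P)` of an open set `Ω` of `ℝ^d`: `cells` is the family `M` of
control volumes, `edges` is the family `E` of edges, `edgesOf K` is the subset `E_K` of `E` that is
attached to the control volume `K`, and `point K` is the point `x_K`.
(The values of `edgesOf` and `point` outside `cells` are irrelevant.) -/
structure SpaceDiscretisation {d : ℕ} (Ω : Set (EuclideanSpace ℝ (Fin d))) where
  cells : Finset (Set (EuclideanSpace ℝ (Fin d)))
  edges : Finset (Set (EuclideanSpace ℝ (Fin d)))
  edgesOf : Set (EuclideanSpace ℝ (Fin d)) → Finset (Set (EuclideanSpace ℝ (Fin d)))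
  point : Set (EuclideanSpace ℝ (Fin d)) → EuclideanSpace ℝ (Fin d)
  cell_subset : ∀ K ∈ cells, K ⊆ Ω
  cell_isOpen : ∀ K ∈ cells, IsOpen K
  cell_isConnected : ∀ K ∈ cells, IsConnected K
  cell_disjoint : ∀ K ∈ cells, ∀ L ∈ cells, K ≠ L → Disjoint K L
  closure_eq : closure Ω = ⋃ K ∈ cells, closure K
  edge_subset : ∀ σ ∈ edges, σ ⊆ closure Ω
  edge_nonempty : ∀ σ ∈ edges, σ.Nonempty
  edge_disjoint : ∀ σ ∈ edges, ∀ τ ∈ edges, σ ≠ τ → Disjoint σ τ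
  /-- Each edge is an open subset of a hyperplane. -/
  edge_open_in_hyperplane : ∀ σ ∈ edges,
    ∃ H : AffineSubspace ℝ (EuclideanSpace ℝ (Fin d)),
      Module.finrank ℝ H.direction + 1 = d ∧
        ∃ U : Set (EuclideanSpace ℝ (Fin d)), IsOpen U ∧ σ = U ∩ H
  edge_measure_pos : ∀ σ ∈ edges, 0 < surfaceMeasure d σ
  /-- The boundary of an edge relative to its hyperplane is negligible. -/
  edge_boundary_null : ∀ σ ∈ edges, surfaceMeasure d (closure σ \ σ) = 0
  edgesOf_subset : ∀ K ∈ cells, edgesOf K ⊆ edges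
  cell_boundary : ∀ K ∈ cells, frontier K = ⋃ σ ∈ edgesOf K, closure σ
  /-- An edge belongs either to exactly one control volume, and then lies on the boundary of `Ω`,
  or to exactly two control volumes. -/
  edge_cells : ∀ σ ∈ edges,
    ({K | K ∈ cells ∧ σ ∈ edgesOf K}.ncard = 1 ∧ σ ⊆ frontier Ω) ∨
      {K | K ∈ cells ∧ σ ∈ edgesOf K}.ncard = 2
  point_mem : ∀ K ∈ cells, point K ∈ K
  cell_starConvex : ∀ K ∈ cells, StarConvex ℝ (point K) K
  /-- The distance `d_{K,σ}` of `x_K` to the hyperplane that includes `σ` is positive; as `σ` is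
  nonempty and open in its hyperplane, this hyperplane is the affine span of `σ`. -/
  dist_pos : ∀ K ∈ cells, ∀ σ ∈ edgesOf K,
    0 < Metric.infDist (point K) (affineSpan ℝ σ : Set (EuclideanSpace ℝ (Fin d)))

namespace SpaceDiscretisation

variable {d : ℕ} {Ω : Set (EuclideanSpace ℝ (Fin d))} (D : SpaceDiscretisation Ω)

open Classical in
/-- The set `M_σ` of the control volumes that have `σ` among their edges. -/
noncomputable def cellsOf (σ : Set (EuclideanSpace ℝ (Fin d))) :
    Finset (Set (EuclideanSpace ℝ (Fin d))) :=
  D.cells.filter fun K => σ ∈ D.edgesOf K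

/-- `d_{K,σ}`: the Euclidean distance between `x_K` and the hyperplane including `σ`. -/
noncomputable def dist (K σ : Set (EuclideanSpace ℝ (Fin d))) : ℝ :=
  Metric.infDist (D.point K) (affineSpan ℝ σ : Set (EuclideanSpace ℝ (Fin d)))

/-- `d_σ`, which is `d_{K,σ} + d_{L,σ}` if `M_σ = {K, L}` and `d_{K,σ}` if `M_σ = {K}`. -/
noncomputable def edgeDist (σ : Set (EuclideanSpace ℝ (Fin d))) : ℝ :=
  ∑ K ∈ D.cellsOf σ, D.dist K σ

/-- `H_M(Ω)`: the functions that are constant on each control volume (only the values on `Ω` of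
such a function are used; `Ω` is the union of the control volumes up to a negligible set). -/
def PiecewiseConstant (u : EuclideanSpace ℝ (Fin d) → ℝ) : Prop :=
  ∀ K ∈ D.cells, ∃ c : ℝ, ∀ x ∈ K, u x = c

/-- The value `u_K` on the control volume `K` of a piecewise constant function `u`. -/
def cellValue (u : EuclideanSpace ℝ (Fin d) → ℝ) (K : Set (EuclideanSpace ℝ (Fin d))) : ℝ :=
  u (D.point K)

open Classical in
/-- `D_σ u`, for an edge `σ` of the control volume `K`: it is `|u_K - u_L|` if `M_σ = {K, L}` and
`|u_K|` if `M_σ = {K}` (see `jump_interior` and `jump_boundary`). -/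
noncomputable def jump (u : EuclideanSpace ℝ (Fin d) → ℝ)
    (K σ : Set (EuclideanSpace ℝ (Fin d))) : ℝ :=
  |D.cellValue u K - ∑ L ∈ (D.cellsOf σ).erase K, D.cellValue u L|

/-- The discrete `W^{1,p}` norm
`(∑_{K ∈ M} ∑_{σ ∈ E_K} |σ| d_{K,σ} (D_σ u / d_σ) ^ p) ^ (1 / p)`. -/
noncomputable def discreteNorm (p : ℝ) (u : EuclideanSpace ℝ (Fin d) → ℝ) : ℝ :=
  (∑ K ∈ D.cells, ∑ σ ∈ D.edgesOf K,
    (surfaceMeasure d).real σ * D.dist K σ * (D.jump u K σ / D.edgeDist σ) ^ p) ^ (1 / p)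

/-- `η ≤ d_{K,σ} / d_{L,σ} ≤ 1 / η` for every edge `σ` with `M_σ = {K, L}`. -/
def RatioBound (η : ℝ) : Prop :=
  ∀ σ ∈ D.edges, ∀ K ∈ D.cellsOf σ, ∀ L ∈ D.cellsOf σ, K ≠ L →
    η ≤ D.dist K σ / D.dist L σ ∧ D.dist K σ / D.dist L σ ≤ 1 / η

open Classical in
theorem jump_interior (u : EuclideanSpace ℝ (Fin d) → ℝ)
    {K L σ : Set (EuclideanSpace ℝ (Fin d))} (hKL : K ≠ L) (h : D.cellsOf σ = {K, L}) :
    D.jump u K σ = |D.cellValue u K - D.cellValue u L| := by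
  have : ({K, L} : Finset (Set (EuclideanSpace ℝ (Fin d)))).erase K = {L} := by
    ext x
    simp only [Finset.mem_erase, Finset.mem_insert, Finset.mem_singleton]
    grind
  rw [jump, h, this, Finset.sum_singleton]

theorem jump_boundary (u : EuclideanSpace ℝ (Fin d) → ℝ)
    {K σ : Set (EuclideanSpace ℝ (Fin d))} (h : D.cellsOf σ = {K}) :
    D.jump u K σ = |D.cellValue u K| := by
  simp [jump, h]

end SpaceDiscretisation

/-!
For a piecewise constant `v`, extended by `0`, the function `t ↦ v (x + t h)` jumps only where the
segment crosses an edge, and the set of the `x` whose segment crosses `σ` has volume at most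
`|σ| ‖h‖`; hence `‖v (· + h) - v‖_{L¹} ≤ ‖h‖ ‖v‖_{1,1,M}`. A shift that moves `Ω` off itself turns
this into the discrete Poincaré inequality `‖v‖_{L¹} ≤ 2 R ‖v‖_{1,1,M}`.

Both are applied to the signed power `v = |u| ^ (p - 1) u`. Young's inequality bounds `‖v‖_{1,1,M}`
by `ε ‖u‖_{L^p}^p + C_ε ‖u‖_{1,p,M}^p`, the volume term coming from the cones with apex `x_K` and
base `σ`, which are disjoint in `K`, and the Poincaré inequality absorbs the first term because
`‖u‖_{L^p}^p = ‖v‖_{L¹}`. The Kolmogorov criterion makes the functions `v` relatively compact in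
`L¹`, and `|a - b| ^ p ≤ 2 ^ p ||a| ^ (p - 1) a - |b| ^ (p - 1) b|` brings this back to `L^p`.
-/

open Set Filter Topology Module
open scoped RealInnerProductSpace Pointwise

/-- The open cone with apex `z` and base `S`, which contains neither its apex nor its base. -/
def openCone {E : Type*} [AddCommGroup E] [Module ℝ E] (z : E) (S : Set E) : Set E :=
  ⋃ t ∈ Ioo (0 : ℝ) 1, AffineMap.homothety z t '' S

theorem natCast_mul_lintegral_enorm_pow {k : ℕ} (hk : 0 < k) :
    k * ∫⁻ t in Ioo (0 : ℝ) 1, ‖t‖ₑ ^ (k - 1) = 1 := by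
  have hint : IntegrableOn (fun t : ℝ => t ^ (k - 1)) (Ioo 0 1) :=
    (continuous_pow _).integrableOn_Icc.mono_set Ioo_subset_Icc_self
  have hval : ∫ t in Ioo (0 : ℝ) 1, t ^ (k - 1) = (k : ℝ)⁻¹ := by
    rw [← integral_Ioc_eq_integral_Ioo, ← intervalIntegral.integral_of_le zero_le_one, integral_pow,
      ← Nat.cast_add_one, Nat.sub_add_cancel hk]
    simp [hk.ne']
  have hnonneg : ∀ᵐ t ∂volume.restrict (Ioo (0 : ℝ) 1), 0 ≤ t ^ (k - 1) :=
    (ae_restrict_mem measurableSet_Ioo).mono fun t ht => pow_nonneg ht.1.le _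
  simp only [← enorm_pow]
  rw [← ofReal_integral_norm_eq_lintegral_enorm hint,
    integral_congr_ae (hnonneg.mono fun t ht => Real.norm_of_nonneg ht), hval,
    ENNReal.ofReal_inv_of_pos (by positivity), ENNReal.ofReal_natCast,
    ENNReal.mul_inv_cancel (by simpa using hk.ne') (by simp)]

theorem openCone_eq_iUnion_preimage {E : Type*} [AddCommGroup E] [Module ℝ E]
    (z : E) (S : Set E) :
    openCone z S = ⋃ t ∈ Ioo (0 : ℝ) 1, AffineMap.homothety z t⁻¹ ⁻¹' S :=
  iUnion₂_congr fun _ ht => congrFun (image_eq_preimage_of_inverse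
    (fun _ => (AffineMap.homothety_eq_iff_of_mul_eq_one (mul_inv_cancel₀ ht.1.ne')).1 rfl)
    (fun _ => (AffineMap.homothety_eq_iff_of_mul_eq_one (inv_mul_cancel₀ ht.1.ne')).1 rfl)) S

theorem disjoint_openCone {E : Type*} [AddCommGroup E] [Module ℝ E] {z : E} {S T K : Set E}
    (hSK : openCone z S ⊆ K) (hTK : openCone z T ⊆ K) (hS : Disjoint S K) (hT : Disjoint T K)
    (hST : Disjoint S T) : Disjoint (openCone z S) (openCone z T) := by
  have hlt {S T : Set E} (hSK : openCone z S ⊆ K) (hT : Disjoint T K) {s t : ℝ} (hs : 0 < s)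
      (hst : s < t) {x y : E} (hx : x ∈ S) (hy : y ∈ T) :
      AffineMap.homothety z s x ≠ AffineMap.homothety z t y := fun hxy => by
    have ht : 0 < t := hs.trans hst
    have hyx : y = AffineMap.homothety z (t⁻¹ * s) x := by
      rw [AffineMap.homothety_mul_apply, hxy, ← AffineMap.homothety_mul_apply,
        inv_mul_cancel₀ ht.ne', AffineMap.homothety_one, AffineMap.id_apply]
    have hratio : t⁻¹ * s ∈ Ioo (0 : ℝ) 1 :=
      ⟨by positivity, by rwa [inv_mul_eq_div, div_lt_one ht]⟩
    exact disjoint_left.1 hT hy (hSK (mem_biUnion hratio ⟨x, hx, hyx.symm⟩))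
  simp only [disjoint_left, openCone, mem_iUnion₂, exists_prop]
  rintro _ ⟨s, hs, x, hx, rfl⟩ ⟨t, ht, y, hy, hyx⟩
  rcases lt_trichotomy s t with hst | rfl | hts
  · exact hlt hSK hT hs.1 hst hx hy hyx.symm
  · exact disjoint_left.1 hST hx (AffineMap.homothety_injective z hs.1.ne' hyx ▸ hy)
  · exact hlt hTK hS ht.1 hts hy hx hyx

theorem homothety_mem_of_starConvex {E : Type*} [NormedAddCommGroup E] [NormedSpace ℝ E] {z : E}
    {K : Set E} (hK : StarConvex ℝ z K) {A : Set (AffineSubspace ℝ E)} (hA : A.Finite)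
    (hz : ∀ H ∈ A, z ∉ H) (hfr : frontier K ⊆ ⋃ H ∈ A, (H : Set E)) {y : E} (hy : y ∈ closure K)
    {t : ℝ} (ht : t ∈ Ioo (0 : ℝ) 1) : AffineMap.homothety z t y ∈ K := by
  by_contra hmem
  have hfrontier : ∀ s ∈ Ioo t 1, ∃ H ∈ A, AffineMap.homothety z s y ∈ H := fun s hs => by
    have hs0 : 0 < s := ht.1.trans hs.1
    have hclosure : AffineMap.homothety z s y ∈ closure K :=
      map_mem_closure (AffineMap.homothety_continuous z s) hy fun x hx => by
        simpa [AffineMap.homothety_apply, add_comm] using hK.add_smul_sub_mem hx hs0.le hs.2.le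
    have hnot : AffineMap.homothety z s y ∉ K := fun hsK => by
      have := hK.add_smul_sub_mem hsK (div_nonneg ht.1.le hs0.le) ((div_le_one hs0).2 hs.1.le)
      rw [AffineMap.homothety_apply, vsub_eq_sub, vadd_eq_add, add_sub_cancel_right, smul_smul,
        div_mul_cancel₀ _ hs0.ne', add_comm] at this
      exact hmem this
    simpa using hfr ⟨hclosure, fun hint => hnot (interior_subset hint)⟩
  choose! H hHA hH using hfrontier
  obtain ⟨s, hs, s', hs', hne, hHs⟩ := (Ioo_infinite ht.2).exists_ne_map_eq_of_mapsTo hHA hA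
  refine hz (H s) (hHA s hs) ?_
  have hline := AffineMap.lineMap_mem (s / (s - s')) (hH s hs) (hHs ▸ hH s' hs')
  rw [AffineMap.homothety_eq_lineMap, AffineMap.homothety_eq_lineMap, ← AffineMap.apply_lineMap,
    AffineMap.lineMap_apply_ring'] at hline
  have hzero : s / (s - s') * (s' - s) + s = 0 := by
    field_simp [sub_ne_zero.2 hne]
    ring
  rwa [hzero, AffineMap.lineMap_apply_zero] at hline

section Hyperplanes

variable {E : Type*} [NormedAddCommGroup E] [InnerProductSpace ℝ E]

theorem infDist_hyperplane {n : E} (hn : ‖n‖ = 1) (a : ℝ) (z : E) :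
    Metric.infDist z {x | ⟪n, x⟫ = a} = |⟪n, z⟫ - a| := by
  have hfoot : z - (⟪n, z⟫ - a) • n ∈ {x | ⟪n, x⟫ = a} := by
    simp [inner_sub_right, inner_smul_right, hn]
  refine le_antisymm ?_ ((Metric.le_infDist ⟨_, hfoot⟩).2 fun y (hy : ⟪n, y⟫ = a) => ?_)
  · simpa [dist_eq_norm, norm_smul, hn] using Metric.infDist_le_dist_of_mem hfoot (x := z)
  · simpa [← hy, ← inner_sub_right, dist_eq_norm, hn] using abs_real_inner_le_norm n (z - y)

theorem affineSpan_isOpen_inter {U : Set E} (hU : IsOpen U) {H : AffineSubspace ℝ E}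
    (hne : (U ∩ (H : Set E)).Nonempty) : affineSpan ℝ (U ∩ (H : Set E)) = H := by
  obtain ⟨y, hyU, hyH⟩ := hne
  refine le_antisymm (affineSpan_le.2 inter_subset_right) fun x hx => ?_
  have hlim : Tendsto (AffineMap.lineMap y x : ℝ → E) (𝓝[≠] 0) (𝓝 y) := by
    have : Continuous (AffineMap.lineMap y x : ℝ → E) := AffineMap.lineMap_continuous
    simpa using (this.tendsto 0).mono_left nhdsWithin_le_nhds
  obtain ⟨t, htU, ht0⟩ := ((hlim.eventually (hU.mem_nhds hyU)).and self_mem_nhdsWithin).exists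
  have hy : y ∈ affineSpan ℝ (U ∩ (H : Set E)) := subset_affineSpan ℝ _ ⟨hyU, hyH⟩
  have ht : AffineMap.lineMap y x t ∈ affineSpan ℝ (U ∩ (H : Set E)) :=
    subset_affineSpan ℝ _ ⟨htU, AffineMap.lineMap_mem t hyH hx⟩
  have hx' := AffineMap.lineMap_mem t⁻¹ hy ht
  rwa [AffineMap.lineMap_lineMap_right, inv_mul_cancel₀ ht0, AffineMap.lineMap_apply_one] at hx'

theorem iUnion_slices_eq {n : E} {b c : ℝ} (hc : c ≠ 0) {T : ℝ → Set E}
    (hT : ∀ t, T t ⊆ {x | ⟪n, x⟫ = b + t * c}) (I : Set ℝ) :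
    ⋃ t ∈ I, T t = {x | (⟪n, x⟫ - b) / c ∈ I ∧ x ∈ T ((⟪n, x⟫ - b) / c)} := by
  ext x
  simp only [mem_iUnion₂, mem_ofPred_eq, exists_prop]
  refine ⟨?_, fun hx => ⟨_, hx⟩⟩
  rintro ⟨t, ht, hx⟩
  have hparam : (⟪n, x⟫ - b) / c = t := by
    rw [hT t hx, add_sub_cancel_left, mul_div_cancel_right₀ _ hc]
  rw [hparam]
  exact ⟨ht, hx⟩

theorem homothety_inv_preimage_subset_hyperplane {n z : E} {a : ℝ} (hz : ⟪n, z⟫ ≠ a) {S : Set E}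
    (hSa : S ⊆ {x | ⟪n, x⟫ = a}) (t : ℝ) : AffineMap.homothety z t⁻¹ ⁻¹' S ⊆
      {x | ⟪n, x⟫ = ⟪n, z⟫ + t * (a - ⟪n, z⟫)} := fun x hx => by
  have ha : t⁻¹ * (⟪n, x⟫ - ⟪n, z⟫) = a - ⟪n, z⟫ := by
    have : ⟪n, AffineMap.homothety z t⁻¹ x⟫ = a := hSa hx
    rw [AffineMap.homothety_apply, vsub_eq_sub, vadd_eq_add, inner_add_right, inner_smul_right,
      inner_sub_right] at this
    linarith
  have ht : t ≠ 0 := by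
    rintro rfl
    simp [(sub_ne_zero.2 hz.symm).symm] at ha
  rw [mem_ofPred_eq, ← ha, mul_inv_cancel_left₀ ht]
  ring

variable [FiniteDimensional ℝ E]

theorem exists_unit_normal {H : AffineSubspace ℝ E} (hne : (H : Set E).Nonempty)
    (hH : finrank ℝ H.direction + 1 = finrank ℝ E) :
    ∃ (n : E) (a : ℝ), ‖n‖ = 1 ∧ (H : Set E) = {x | ⟪n, x⟫ = a} := by
  obtain ⟨q, hq⟩ := hne
  have hrank : finrank ℝ H.directionᗮ = 1 := by
    have := H.direction.finrank_add_finrank_orthogonal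
    lia
  have : Nontrivial H.directionᗮ := nontrivial_of_finrank_pos (R := ℝ) (by lia)
  obtain ⟨n, hn⟩ := exists_norm_eq H.directionᗮ (zero_le_one (α := ℝ))
  have hn0 : n ≠ 0 := norm_ne_zero_iff.1 (hn ▸ one_ne_zero)
  have hspan : H.directionᗮ = ℝ ∙ (n : E) := by
    refine (Submodule.eq_of_le_of_finrank_eq
      ((Submodule.span_singleton_le_iff_mem _ _).2 n.2) ?_).symm
    rw [finrank_span_singleton (by simpa using hn0), hrank]
  refine ⟨n, ⟪(n : E), q⟫, hn, ext fun x => ?_⟩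
  have hdir (v : E) : v ∈ H.direction ↔ ⟪(n : E), v⟫ = 0 := by
    rw [← Submodule.mem_orthogonal_singleton_iff_inner_right, ← hspan,
      Submodule.orthogonal_orthogonal]
  rw [SetLike.mem_coe, ← AffineSubspace.vsub_right_mem_direction_iff_mem hq, hdir, vsub_eq_sub,
    inner_sub_right, sub_eq_zero, mem_ofPred_eq]

variable [MeasurableSpace E] [BorelSpace E]

theorem volume_eq_lintegral_slices {n : E} (hn : ‖n‖ = 1) (b : ℝ) {c : ℝ} (hc : c ≠ 0)
    {A : Set E} (hA : MeasurableSet A) :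
    volume A = ‖c‖ₑ * ∫⁻ t : ℝ, μHE[finrank ℝ E - 1] (A ∩ {x | ⟪n, x⟫ = b + t * c}) := by
  have hn0 : n ≠ 0 := norm_ne_zero_iff.1 (hn ▸ one_ne_zero)
  rw [← InnerProductSpace.euclideanHausdorffMeasure_eq_volume,
    EuclideanGeometry.euclideanHausdorffMeasure_eq_lintegral (b • n) (smul_ne_zero hc hn0) hA]
  have hslice (t : ℝ) :
      (AffineSubspace.mk' (t • c • n +ᵥ b • n) (ℝ ∙ (c • n))ᗮ : Set E) =
        {x | ⟪n, x⟫ = b + t * c} := by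
    ext x
    rw [Submodule.span_singleton_smul_eq hc.isUnit]
    simp [AffineSubspace.mem_mk', Submodule.mem_orthogonal_singleton_iff_inner_right,
      inner_sub_right, inner_add_right, inner_smul_right, hn, sub_eq_zero, add_comm]
  simp only [hslice]
  rw [enorm_smul, ← ofReal_norm n, hn, ENNReal.ofReal_one, mul_one]

theorem volume_hyperplane {n : E} (hn : ‖n‖ = 1) (a : ℝ) : volume {x | ⟪n, x⟫ = a} = 0 := by
  have hmeas : MeasurableSet {x | ⟪n, x⟫ = a} :=
    (isClosed_eq (by fun_prop) continuous_const).measurableSet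
  rw [volume_eq_lintegral_slices hn a one_ne_zero hmeas, lintegral_eq_zero_of_ae_eq_zero, mul_zero]
  filter_upwards [Measure.ae_ne volume (0 : ℝ)] with t ht
  have : {x | ⟪n, x⟫ = a} ∩ {x | ⟪n, x⟫ = a + t * 1} = ∅ := by
    ext x
    simp only [mem_inter_iff, mem_ofPred_eq, mem_empty_iff_false, iff_false]
    rintro ⟨rfl, h⟩
    simp [ht] at h
  rw [this, measure_empty, Pi.zero_apply]

theorem measurableSet_iUnion_slices {n : E} {b c : ℝ} (hc : c ≠ 0) {T : ℝ → Set E}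
    (hT : ∀ t, T t ⊆ {x | ⟪n, x⟫ = b + t * c}) (hmeas : MeasurableSet {p : ℝ × E | p.2 ∈ T p.1})
    {I : Set ℝ} (hI : MeasurableSet I) : MeasurableSet (⋃ t ∈ I, T t) := by
  have hparam : Measurable fun x => (⟪n, x⟫ - b) / c := by fun_prop
  rw [iUnion_slices_eq hc hT]
  exact (hparam hI).inter ((hparam.prodMk measurable_id) hmeas)

theorem volume_iUnion_slices {n : E} (hn : ‖n‖ = 1) (b : ℝ) {c : ℝ} (hc : c ≠ 0)
    {T : ℝ → Set E} (hT : ∀ t, T t ⊆ {x | ⟪n, x⟫ = b + t * c})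
    (hmeas : MeasurableSet {p : ℝ × E | p.2 ∈ T p.1}) {I : Set ℝ} (hI : MeasurableSet I) :
    volume (⋃ t ∈ I, T t) = ‖c‖ₑ * ∫⁻ t in I, μHE[finrank ℝ E - 1] (T t) := by
  have hslice (t : ℝ) : (⋃ t ∈ I, T t) ∩ {x | ⟪n, x⟫ = b + t * c} = {x | x ∈ T t ∧ t ∈ I} := by
    ext x
    have hparam (hx : ⟪n, x⟫ = b + t * c) : (⟪n, x⟫ - b) / c = t := by
      rw [hx, add_sub_cancel_left, mul_div_cancel_right₀ _ hc]
    rw [iUnion_slices_eq hc hT]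
    refine ⟨?_, fun ⟨hx, ht⟩ => ⟨?_, hT t hx⟩⟩
    · rintro ⟨⟨ht, hx⟩, hxt⟩
      exact hparam hxt ▸ ⟨hx, ht⟩
    · rw [mem_ofPred_eq, hparam (hT t hx)]
      exact ⟨ht, hx⟩
  rw [volume_eq_lintegral_slices hn b hc (measurableSet_iUnion_slices hc hT hmeas hI),
    ← lintegral_indicator hI]
  refine congrArg _ (lintegral_congr fun t => ?_)
  by_cases ht : t ∈ I <;> simp [hslice, ht]

theorem volume_sweep {n : E} (hn : ‖n‖ = 1) {a : ℝ} {S : Set E} (hS : MeasurableSet S)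
    (hSa : S ⊆ {x | ⟪n, x⟫ = a}) (h : E) :
    volume (⋃ t ∈ Ioo (0 : ℝ) 1, (· + t • h) ⁻¹' S) = ‖⟪n, h⟫‖ₑ * μHE[finrank ℝ E - 1] S := by
  have hslice (t : ℝ) : (· + t • h) ⁻¹' S ⊆ {x | ⟪n, x⟫ = a + t * -⟪n, h⟫} := fun x hx => by
    have : ⟪n, x + t • h⟫ = a := hSa hx
    rw [inner_add_right, inner_smul_right] at this
    rw [mem_ofPred_eq]
    linarith
  by_cases hnh : ⟪n, h⟫ = 0
  · rw [hnh, enorm_zero, zero_mul]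
    refine measure_mono_null (iUnion₂_subset fun t _ => ?_) (volume_hyperplane hn a)
    simpa [hnh] using hslice t
  rw [volume_iUnion_slices hn a (neg_ne_zero.2 hnh) hslice
    ((by fun_prop : Measurable fun p : ℝ × E => p.2 + p.1 • h) hS) measurableSet_Ioo]
  have hμ (t : ℝ) : μHE[finrank ℝ E - 1] ((· + t • h) ⁻¹' S) = μHE[finrank ℝ E - 1] S := by
    simpa only [vadd_eq_add, add_comm] using measure_preimage_vadd (μHE[finrank ℝ E - 1]) (t • h) S
  simp [hμ]

theorem measurableSet_homothety_inv_preimage (z : E) {S : Set E} (hS : MeasurableSet S) :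
    MeasurableSet {p : ℝ × E | p.2 ∈ AffineMap.homothety z p.1⁻¹ ⁻¹' S} := by
  refine (?_ : Measurable fun p : ℝ × E => AffineMap.homothety z p.1⁻¹ p.2) hS
  simp only [AffineMap.homothety_apply, vsub_eq_sub, vadd_eq_add]
  fun_prop

theorem measurableSet_openCone {n z : E} {a : ℝ} (hz : ⟪n, z⟫ ≠ a) {S : Set E}
    (hS : MeasurableSet S) (hSa : S ⊆ {x | ⟪n, x⟫ = a}) : MeasurableSet (openCone z S) := by
  rw [openCone_eq_iUnion_preimage]
  exact measurableSet_iUnion_slices (sub_ne_zero.2 hz.symm)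
    (homothety_inv_preimage_subset_hyperplane hz hSa)
    (measurableSet_homothety_inv_preimage z hS) measurableSet_Ioo

theorem finrank_mul_volume_openCone {n : E} (hn : ‖n‖ = 1) {a : ℝ} {z : E} (hz : ⟪n, z⟫ ≠ a)
    {S : Set E} (hS : MeasurableSet S) (hSa : S ⊆ {x | ⟪n, x⟫ = a}) :
    finrank ℝ E * volume (openCone z S) = ‖⟪n, z⟫ - a‖ₑ * μHE[finrank ℝ E - 1] S := by
  have hμ : ∀ t ∈ Ioo (0 : ℝ) 1, μHE[finrank ℝ E - 1] (AffineMap.homothety z t⁻¹ ⁻¹' S) =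
      ‖t‖ₑ ^ (finrank ℝ E - 1) * μHE[finrank ℝ E - 1] S := fun t ht => by
    rw [euclideanHausdorffMeasure_homothety_preimage _ _ (inv_ne_zero ht.1.ne'), nnnorm_inv,
      inv_inv, ENNReal.smul_def, smul_eq_mul, ENNReal.coe_pow, enorm_eq_nnnorm]
  have hpos : 0 < finrank ℝ E :=
    have : Nontrivial E := ⟨n, 0, norm_ne_zero_iff.1 (hn ▸ one_ne_zero)⟩
    finrank_pos
  rw [openCone_eq_iUnion_preimage, volume_iUnion_slices hn _ (sub_ne_zero.2 hz.symm)
      (homothety_inv_preimage_subset_hyperplane hz hSa)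
      (measurableSet_homothety_inv_preimage z hS) measurableSet_Ioo,
    setLIntegral_congr_fun measurableSet_Ioo hμ, lintegral_mul_const _ (by fun_prop),
    mul_left_comm, ← mul_assoc (finrank ℝ E : ℝ≥0∞), natCast_mul_lintegral_enorm_pow hpos, one_mul,
    ← enorm_neg, neg_sub]

theorem euclideanHausdorffMeasure_lt_top_of_subset_hyperplane {n : E} (hn : ‖n‖ = 1) {a : ℝ}
    {S : Set E} (hS : MeasurableSet S) (hSa : S ⊆ {x | ⟪n, x⟫ = a})
    (hb : Bornology.IsBounded S) : μHE[finrank ℝ E - 1] S < ∞ := by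
  have hsweep := volume_sweep hn hS hSa n
  rw [real_inner_self_eq_norm_sq, hn, one_pow, enorm_one, one_mul] at hsweep
  rw [← hsweep]
  refine (measure_mono (iUnion₂_subset fun t ht x hx => ?_)).trans_lt
    (hb.cthickening (δ := 1)).measure_lt_top
  refine Metric.mem_cthickening_of_dist_le _ _ _ _ hx ?_
  simpa [dist_eq_norm, norm_smul, hn, abs_of_pos ht.1] using ht.2.le

end Hyperplanes

namespace SpaceDiscretisation

variable {d : ℕ} {Ω : Set (EuclideanSpace ℝ (Fin d))} (D : SpaceDiscretisation Ω)
  {K L σ τ : Set (EuclideanSpace ℝ (Fin d))}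

/-- The union of the closed edges, which contains the boundaries of all the control volumes. -/
def skeleton : Set (EuclideanSpace ℝ (Fin d)) :=
  ⋃ σ ∈ D.edges, closure σ

/-- The union of the relative boundaries of the edges. -/
def ridges : Set (EuclideanSpace ℝ (Fin d)) :=
  ⋃ σ ∈ D.edges, closure σ \ σ

theorem exists_unit_normal_edge (hσ : σ ∈ D.edges) :
    ∃ (n : EuclideanSpace ℝ (Fin d)) (a : ℝ), ‖n‖ = 1 ∧
      (affineSpan ℝ σ : Set (EuclideanSpace ℝ (Fin d))) = {x | ⟪n, x⟫ = a} := by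
  obtain ⟨H, hH, U, hU, rfl⟩ := D.edge_open_in_hyperplane σ hσ
  have hne := D.edge_nonempty _ hσ
  rw [affineSpan_isOpen_inter hU hne]
  exact exists_unit_normal (hne.mono inter_subset_right) (by rwa [finrank_euclideanSpace_fin])

theorem exists_isOpen_edge_eq_inter (hσ : σ ∈ D.edges) :
    ∃ U : Set (EuclideanSpace ℝ (Fin d)), IsOpen U ∧ σ = U ∩ affineSpan ℝ σ := by
  obtain ⟨H, -, U, hU, rfl⟩ := D.edge_open_in_hyperplane σ hσ
  exact ⟨U, hU, by rw [affineSpan_isOpen_inter hU (D.edge_nonempty _ hσ)]⟩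

theorem closure_subset_affineSpan : closure σ ⊆ affineSpan ℝ σ :=
  closure_minimal (subset_affineSpan ℝ σ) (AffineSubspace.closed_of_finiteDimensional _)

theorem measurableSet_edge (hσ : σ ∈ D.edges) : MeasurableSet σ := by
  obtain ⟨U, hU, hσU⟩ := D.exists_isOpen_edge_eq_inter hσ
  rw [hσU]
  exact hU.measurableSet.inter (AffineSubspace.closed_of_finiteDimensional _).measurableSet

theorem mem_cellsOf : K ∈ D.cellsOf σ ↔ K ∈ D.cells ∧ σ ∈ D.edgesOf K := by
  rw [cellsOf, Finset.mem_filter]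

theorem card_cellsOf (hσ : σ ∈ D.edges) :
    (D.cellsOf σ).card = 1 ∨ (D.cellsOf σ).card = 2 := by
  have hset : {K | K ∈ D.cells ∧ σ ∈ D.edgesOf K} = (D.cellsOf σ : Set _) :=
    ext fun K => D.mem_cellsOf.symm
  have hcells := D.edge_cells σ hσ
  rw [hset, ncard_coe_finset] at hcells
  exact hcells.imp_left And.left

theorem cellsOf_nonempty (hσ : σ ∈ D.edges) : (D.cellsOf σ).Nonempty :=
  Finset.card_pos.1 (by rcases D.card_cellsOf hσ with h | h <;> omega)

open Classical in
theorem cellsOf_eq_singleton_or_pair (hK : K ∈ D.cellsOf σ) :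
    D.cellsOf σ = {K} ∨ ∃ L, K ≠ L ∧ D.cellsOf σ = {K, L} := by
  have hσ : σ ∈ D.edges := D.edgesOf_subset K (D.mem_cellsOf.1 hK).1 (D.mem_cellsOf.1 hK).2
  refine (D.card_cellsOf hσ).imp (fun h => ?_) fun h => ?_
  · obtain ⟨K', hK'⟩ := Finset.card_eq_one.1 h
    rw [hK', Finset.mem_singleton] at hK
    rw [hK', hK]
  · obtain ⟨K₁, K₂, hne, h⟩ := Finset.card_eq_two.1 h
    rw [h, Finset.mem_insert, Finset.mem_singleton] at hK
    rcases hK with rfl | rfl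
    · exact ⟨K₂, hne, h⟩
    · exact ⟨K₁, hne.symm, h.trans (Finset.pair_comm K₁ K)⟩

theorem frontier_cell_subset_skeleton (hK : K ∈ D.cells) : frontier K ⊆ D.skeleton := by
  rw [D.cell_boundary K hK]
  exact biUnion_subset_biUnion_left (D.edgesOf_subset K hK)

theorem edge_subset_frontier (hK : K ∈ D.cells) (hσ : σ ∈ D.edgesOf K) : σ ⊆ frontier K := by
  rw [D.cell_boundary K hK]
  exact subset_closure.trans (subset_biUnion_of_mem (u := closure) hσ)

theorem disjoint_edge_cell (hK : K ∈ D.cells) (hσ : σ ∈ D.edgesOf K) : Disjoint σ K :=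
  (disjoint_frontier_iff_isOpen.2 (D.cell_isOpen K hK)).mono_left
    (D.edge_subset_frontier hK hσ)

theorem volume_skeleton : volume D.skeleton = 0 :=
  (measure_biUnion_null_iff D.edges.countable_toSet).2 fun σ hσ => by
    obtain ⟨n, a, hn, hspan⟩ := D.exists_unit_normal_edge hσ
    exact measure_mono_null (hspan ▸ closure_subset_affineSpan) (volume_hyperplane hn a)

theorem surfaceMeasure_eq (d : ℕ) :
    surfaceMeasure d = μHE[finrank ℝ (EuclideanSpace ℝ (Fin d)) - 1] := by
  rw [surfaceMeasure, finrank_euclideanSpace_fin]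

theorem surfaceMeasure_edge_lt_top (hb : Bornology.IsBounded Ω) (hσ : σ ∈ D.edges) :
    surfaceMeasure d σ < ∞ := by
  obtain ⟨n, a, hn, hspan⟩ := D.exists_unit_normal_edge hσ
  rw [surfaceMeasure_eq]
  exact euclideanHausdorffMeasure_lt_top_of_subset_hyperplane hn (D.measurableSet_edge hσ)
    (hspan ▸ subset_affineSpan ℝ σ) (hb.closure.subset (D.edge_subset σ hσ))

theorem openCone_subset_cell (hK : K ∈ D.cells) (hσ : σ ∈ D.edgesOf K) :
    openCone (D.point K) σ ⊆ K := by
  refine iUnion₂_subset fun t ht => image_subset_iff.2 fun y hy => ?_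
  refine homothety_mem_of_starConvex (D.cell_starConvex K hK)
    (A := affineSpan ℝ '' D.edgesOf K) ((D.edgesOf K).finite_toSet.image _) ?_ ?_
    (frontier_subset_closure (D.edge_subset_frontier hK hσ hy)) ht
  · rintro _ ⟨τ, hτ, rfl⟩ hmem
    exact (D.dist_pos K hK τ hτ).ne' (Metric.infDist_zero_of_mem hmem)
  · rw [D.cell_boundary K hK, biUnion_image]
    exact iUnion₂_mono fun τ _ => closure_subset_affineSpan

theorem dist_pos_of_mem_cellsOf (hK : K ∈ D.cellsOf σ) : 0 < D.dist K σ :=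
  D.dist_pos K (D.mem_cellsOf.1 hK).1 σ (D.mem_cellsOf.1 hK).2

theorem exists_unit_normal_of_mem_edgesOf (hK : K ∈ D.cells) (hσ : σ ∈ D.edgesOf K) :
    ∃ (n : EuclideanSpace ℝ (Fin d)) (a : ℝ), ‖n‖ = 1 ∧ σ ⊆ {x | ⟪n, x⟫ = a} ∧
      ⟪n, D.point K⟫ ≠ a ∧ D.dist K σ = |⟪n, D.point K⟫ - a| := by
  obtain ⟨n, a, hn, hspan⟩ := D.exists_unit_normal_edge (D.edgesOf_subset K hK hσ)
  have hdist : D.dist K σ = |⟪n, D.point K⟫ - a| := by rw [dist, hspan, infDist_hyperplane hn]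
  have hpos : 0 < D.dist K σ := D.dist_pos K hK σ hσ
  rw [hdist, abs_pos, sub_ne_zero] at hpos
  exact ⟨n, a, hn, hspan ▸ subset_affineSpan ℝ σ, hpos, hdist⟩

theorem sum_surfaceMeasure_mul_dist_le (hb : Bornology.IsBounded Ω) (hK : K ∈ D.cells) :
    ∑ σ ∈ D.edgesOf K, (surfaceMeasure d).real σ * D.dist K σ ≤ d * volume.real K := by
  choose! n a hn hσ hne hdist using fun σ hσ => D.exists_unit_normal_of_mem_edgesOf (σ := σ) hK hσ
  have hmeas σ (hσK : σ ∈ D.edgesOf K) : MeasurableSet σ :=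
    D.measurableSet_edge (D.edgesOf_subset K hK hσK)
  have hfin : volume K ≠ ∞ := (hb.subset (D.cell_subset K hK)).measure_lt_top.ne
  have hcone σ (hσK : σ ∈ D.edgesOf K) : (surfaceMeasure d).real σ * D.dist K σ =
      d * volume.real (openCone (D.point K) σ) := by
    have := finrank_mul_volume_openCone (hn σ hσK) (hne σ hσK) (hmeas σ hσK) (hσ σ hσK)
    rw [← surfaceMeasure_eq, finrank_euclideanSpace_fin] at this
    simpa [measureReal_def, hdist σ hσK, mul_comm] using (congrArg ENNReal.toReal this).symm
  rw [Finset.sum_congr rfl hcone, ← Finset.mul_sum]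
  gcongr
  rw [← measureReal_biUnion_finset (h := fun σ hσK =>
    measure_ne_top_of_subset (D.openCone_subset_cell hK hσK) hfin)]
  · exact measureReal_mono (iUnion₂_subset fun σ hσK => D.openCone_subset_cell hK hσK) hfin
  · intro σ hσK τ hτK hστ
    exact disjoint_openCone (D.openCone_subset_cell hK hσK) (D.openCone_subset_cell hK hτK)
      (D.disjoint_edge_cell hK hσK) (D.disjoint_edge_cell hK hτK)
      (D.edge_disjoint σ (D.edgesOf_subset K hK hσK) τ (D.edgesOf_subset K hK hτK) hστ)
  · exact fun σ hσK => measurableSet_openCone (hne σ hσK) (hmeas σ hσK) (hσ σ hσK)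

end SpaceDiscretisation

theorem dist_le_sum_of_jumps {α ι : Type*} [PseudoMetricSpace α] {f : ℝ → α} {A : Finset ι}
    {τ : ι → ℝ} {c : ι → ℝ} {a b : ℝ} (hab : a ≤ b) (hinj : InjOn τ A)
    (hτ : ∀ i ∈ A, τ i ∈ Ioo a b)
    (hconst : ∀ s t, a ≤ s → s ≤ t → t ≤ b → (∀ i ∈ A, τ i ∉ Icc s t) → f s = f t)
    (hjump : ∀ i ∈ A, ∀ᶠ s in 𝓝[<] τ i, ∀ᶠ t in 𝓝[>] τ i, dist (f s) (f t) ≤ c i) :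
    dist (f a) (f b) ≤ ∑ i ∈ A, c i := by
  classical
  induction A using Finset.induction_on_max_value τ generalizing b with
  | empty => simp [hconst a b le_rfl hab le_rfl (by simp)]
  | insert i A hi hmax ih =>
    have hlt : ∀ j ∈ A, τ j < τ i := fun j hj => (hmax j hj).lt_of_ne fun h =>
      hi (hinj (by simp [hj]) (by simp) h ▸ hj)
    obtain ⟨ha, hb⟩ := hτ i (Finset.mem_insert_self i A)
    have hleft : ∀ᶠ s in 𝓝[<] τ i, a < s ∧ s < τ i ∧ ∀ j ∈ A, τ j < s :=
      (eventually_nhdsWithin_of_eventually_nhds (lt_mem_nhds ha)).and <|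
        eventually_mem_nhdsWithin.and <| (Finset.eventually_all A).2 fun j hj =>
          eventually_nhdsWithin_of_eventually_nhds (lt_mem_nhds (hlt j hj))
    have hright : ∀ᶠ t in 𝓝[>] τ i, τ i < t ∧ t < b :=
      eventually_mem_nhdsWithin.and (eventually_nhdsWithin_of_eventually_nhds (gt_mem_nhds hb))
    obtain ⟨s, hs, has, hsi, hAs⟩ := ((hjump i (Finset.mem_insert_self i A)).and hleft).exists
    obtain ⟨t, hst, hit, htb⟩ := (hs.and hright).exists
    have hbefore : dist (f a) (f s) ≤ ∑ j ∈ A, c j :=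
      ih has.le (hinj.mono (by simp))
        (fun j hj => ⟨(hτ j (Finset.mem_insert_of_mem hj)).1, hAs j hj⟩)
        (fun r r' har hrr' hr's hA => hconst r r' har hrr' (by linarith) fun j hj hjmem => by
          rcases Finset.mem_insert.1 hj with rfl | hj
          · linarith [hjmem.2]
          · exact hA j hj hjmem)
        fun j hj => hjump j (Finset.mem_insert_of_mem hj)
    have hafter : f t = f b := hconst t b (by linarith) htb.le le_rfl fun j hj hjmem => by
      rcases Finset.mem_insert.1 hj with rfl | hj
      · linarith [hjmem.1]
      · linarith [hjmem.1, hlt j hj]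
    rw [Finset.sum_insert hi, ← hafter]
    linarith [dist_triangle (f a) (f s) (f t)]

theorem subset_of_isPreconnected_of_disjoint_frontier {X : Type*} [TopologicalSpace X]
    {A K : Set X} (hA : IsPreconnected A) (hK : IsOpen K) (hfr : Disjoint A (frontier K))
    (hne : (A ∩ K).Nonempty) : A ⊆ K := by
  refine hA.subset_left_of_subset_union hK isClosed_closure.isOpen_compl
    (disjoint_compl_right_iff_subset.2 subset_closure) (fun x hx => ?_) hne
  by_contra hxK
  rw [mem_union, mem_compl_iff, not_or, not_not] at hxK
  exact disjoint_left.1 hfr hx (hK.frontier_eq ▸ ⟨hxK.2, hxK.1⟩)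

theorem eq_of_add_smul_mem_of_notMem {k V : Type*} [Field k] [AddCommGroup V] [Module k V]
    {H : AffineSubspace k V} {x v : V} (hx : x ∉ H) {s t : k} (hs : x + s • v ∈ H)
    (ht : x + t • v ∈ H) : s = t := by
  by_contra hst
  have hne : s - t ≠ 0 := sub_ne_zero.2 hst
  refine hx ?_
  convert AffineMap.lineMap_mem (s / (s - t)) hs ht
  rw [AffineMap.lineMap_apply_module']
  match_scalars <;> field_simp <;> ring

namespace SpaceDiscretisation

variable {d : ℕ} {Ω : Set (EuclideanSpace ℝ (Fin d))} (D : SpaceDiscretisation Ω)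
  {K L σ τ A : Set (EuclideanSpace ℝ (Fin d))} (u : EuclideanSpace ℝ (Fin d) → ℝ)
  {x y z h : EuclideanSpace ℝ (Fin d)}

/-- The piecewise constant function equal to `u_K` on each control volume `K` and to `0` off the
control volumes. It represents `u` extended by `0` outside `Ω`. -/
noncomputable def stepFun (x : EuclideanSpace ℝ (Fin d)) : ℝ :=
  ∑ K ∈ D.cells, K.indicator (fun _ => D.cellValue u K) x

theorem stepFun_of_mem (hK : K ∈ D.cells) (hx : x ∈ K) : D.stepFun u x = D.cellValue u K := by
  rw [stepFun, Finset.sum_eq_single_of_mem K hK, indicator_of_mem hx]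
  exact fun L hL hLK => indicator_of_notMem (disjoint_right.1 (D.cell_disjoint L hL K hK hLK) hx) _

theorem stepFun_of_notMem (hx : ∀ K ∈ D.cells, x ∉ K) : D.stepFun u x = 0 :=
  Finset.sum_eq_zero fun K hK => indicator_of_notMem (hx K hK) _

theorem stepFun_comp {g : ℝ → ℝ} (hg : g 0 = 0) : D.stepFun (g ∘ u) = g ∘ D.stepFun u := by
  funext x
  by_cases hx : ∃ K ∈ D.cells, x ∈ K
  · obtain ⟨K, hK, hxK⟩ := hx
    rw [Function.comp_apply, D.stepFun_of_mem _ hK hxK, D.stepFun_of_mem _ hK hxK]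
    rfl
  · push Not at hx
    rw [Function.comp_apply, D.stepFun_of_notMem _ hx, D.stepFun_of_notMem _ hx, hg]

theorem stepFun_eq_of_isPreconnected (hA : IsPreconnected A) (hAD : Disjoint A D.skeleton)
    (hx : x ∈ A) (hy : y ∈ A) : D.stepFun u x = D.stepFun u y := by
  have hsub {x} (hx : x ∈ A) {K} (hK : K ∈ D.cells) (hxK : x ∈ K) : A ⊆ K :=
    subset_of_isPreconnected_of_disjoint_frontier hA (D.cell_isOpen K hK)
      (hAD.mono_right (D.frontier_cell_subset_skeleton hK)) ⟨x, hx, hxK⟩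
  refine Finset.sum_congr rfl fun K hK => ?_
  rw [← indicator_const_eq_indicator_const]
  exact ⟨fun hyK => hsub hy hK hyK hx, fun hxK => hsub hx hK hxK hy⟩

theorem eventually_mem_skeleton_imp_mem_affineSpan (hσ : σ ∈ D.edges) (hy : y ∈ σ)
    (hreg : y ∉ D.ridges) : ∀ᶠ x in 𝓝 y, x ∈ D.skeleton → x ∈ affineSpan ℝ σ := by
  have hother : ∀ τ ∈ D.edges, τ ≠ σ → ∀ᶠ x in 𝓝 y, x ∉ closure τ := fun τ hτ hne =>
    isClosed_closure.isOpen_compl.mem_nhds fun hyτ => hreg <|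
      mem_biUnion hτ ⟨hyτ, disjoint_right.1 (D.edge_disjoint τ hτ σ hσ hne) hy⟩
  have hall : ∀ᶠ x in 𝓝 y, ∀ τ ∈ D.edges, τ ≠ σ → x ∉ closure τ :=
    (Finset.eventually_all D.edges).2 fun τ hτ => eventually_imp_distrib_left.2 (hother τ hτ)
  filter_upwards [hall] with x hx hmem
  obtain ⟨τ, hτ, hxτ⟩ := mem_iUnion₂.1 hmem
  have hτσ : τ = σ := by_contra fun hne => hx τ hτ hne hxτ
  exact closure_subset_affineSpan (hτσ ▸ hxτ)

theorem mem_closure_of_mem_cellsOf (hy : y ∈ σ) (hK : K ∈ D.cellsOf σ) : y ∈ closure K :=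
  frontier_subset_closure <|
    D.edge_subset_frontier (D.mem_cellsOf.1 hK).1 (D.mem_cellsOf.1 hK).2 hy

theorem mem_cellsOf_of_mem_closure (hσ : σ ∈ D.edges) (hy : y ∈ σ) (hreg : y ∉ D.ridges)
    (hK : K ∈ D.cells) (hyK : y ∈ closure K) : K ∈ D.cellsOf σ := by
  by_contra hKσ
  obtain ⟨L, hL⟩ := D.cellsOf_nonempty hσ
  have hKL : K ≠ L := fun h => hKσ (h ▸ hL)
  have hy_notMem : y ∉ K := disjoint_right.1
    ((D.cell_disjoint K hK L (D.mem_cellsOf.1 hL).1 hKL).closure_right (D.cell_isOpen K hK))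
    (D.mem_closure_of_mem_cellsOf hy hL)
  have hfr : y ∈ frontier K := (D.cell_isOpen K hK).frontier_eq ▸ ⟨hyK, hy_notMem⟩
  rw [D.cell_boundary K hK] at hfr
  obtain ⟨τ, hτ, hyτ⟩ := mem_iUnion₂.1 hfr
  have hτE := D.edgesOf_subset K hK hτ
  have hτσ : τ ≠ σ := fun h => hKσ (D.mem_cellsOf.2 ⟨hK, h ▸ hτ⟩)
  exact hreg (mem_biUnion hτE ⟨hyτ, disjoint_right.1 (D.edge_disjoint τ hτE σ hσ hτσ) hy⟩)

theorem eventually_mem_cell_imp_mem_cellsOf (hσ : σ ∈ D.edges) (hy : y ∈ σ)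
    (hreg : y ∉ D.ridges) : ∀ᶠ x in 𝓝 y, ∀ K ∈ D.cells, x ∈ K → K ∈ D.cellsOf σ := by
  refine (Finset.eventually_all D.cells).2 fun K hK => ?_
  by_cases hyK : y ∈ closure K
  · exact .of_forall fun _ _ => D.mem_cellsOf_of_mem_closure hσ hy hreg hK hyK
  · filter_upwards [isClosed_closure.isOpen_compl.mem_nhds hyK] with x hx hxK
    exact absurd (subset_closure hxK) hx

theorem mem_or_mem_of_opposite_sides {n : EuclideanSpace ℝ (Fin d)} {a r : ℝ} (hn : ‖n‖ = 1)
    (hK : K ∈ D.cells) (hyK : y ∈ closure K)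
    (hball : ∀ w ∈ Metric.ball y r, w ∈ D.skeleton → ⟪n, w⟫ = a)
    (hx : x ∈ Metric.ball y r) (hz : z ∈ Metric.ball y r)
    (hxz : (⟪n, x⟫ - a) * (⟪n, z⟫ - a) < 0) : x ∈ K ∨ z ∈ K := by
  have hr : 0 < r := Metric.nonempty_ball.1 ⟨x, hx⟩
  have hdense : Dense {w | ⟪n, w⟫ ≠ a} :=
    Measure.dense_of_ae (measure_eq_zero_iff_ae_notMem.1 (volume_hyperplane hn a))
  obtain ⟨w, ⟨hwr, hwK⟩, hwa⟩ := hdense.inter_open_nonempty _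
    (Metric.isOpen_ball.inter (D.cell_isOpen K hK))
    (mem_closure_iff.1 hyK _ Metric.isOpen_ball (Metric.mem_ball_self hr))
  have hside {v} (hv : v ∈ Metric.ball y r) (hvw : 0 < (⟪n, w⟫ - a) * (⟪n, v⟫ - a)) : v ∈ K := by
    have hconv : Convex ℝ (Metric.ball y r ∩
        {v | (⟪n, w⟫ - a) * a < (innerSL ℝ ((⟪n, w⟫ - a) • n)) v}) :=
      (convex_ball y r).inter (convex_halfSpace_gt (innerSL ℝ _).isLinear _)
    have hmem {v} (h : 0 < (⟪n, w⟫ - a) * (⟪n, v⟫ - a)) :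
        (⟪n, w⟫ - a) * a < (innerSL ℝ ((⟪n, w⟫ - a) • n)) v := by
      rw [innerSL_apply_apply, real_inner_smul_left]
      linarith
    refine subset_of_isPreconnected_of_disjoint_frontier hconv.isPreconnected
      (D.cell_isOpen K hK) (disjoint_left.2 fun v' hv' hfr => ?_)
      ⟨w, ⟨hwr, hmem (mul_self_pos.2 (sub_ne_zero.2 hwa))⟩, hwK⟩ ⟨hv, hmem hvw⟩
    have hv'a := hball v' hv'.1 (D.frontier_cell_subset_skeleton hK hfr)
    have hlt := hv'.2
    rw [mem_ofPred_eq, innerSL_apply_apply, real_inner_smul_left, hv'a] at hlt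
    exact lt_irrefl _ hlt
  have hw0 : 0 < (⟪n, w⟫ - a) ^ 2 := by positivity [sub_ne_zero.2 hwa]
  rcases lt_or_ge 0 ((⟪n, w⟫ - a) * (⟪n, x⟫ - a)) with h | h
  · exact .inl (hside hx h)
  · refine .inr (hside hz ?_)
    by_contra! h'
    nlinarith [mul_nonneg_of_nonpos_of_nonpos h h', mul_neg_of_pos_of_neg hw0 hxz]

theorem abs_stepFun_sub_le_jump
    (hx : ∀ K ∈ D.cells, x ∈ K → K ∈ D.cellsOf σ) (hz : ∀ K ∈ D.cells, z ∈ K → K ∈ D.cellsOf σ)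
    (hxz : ∀ K ∈ D.cellsOf σ, x ∈ K ∨ z ∈ K) (hK : K ∈ D.cellsOf σ) :
    |D.stepFun u x - D.stepFun u z| ≤ D.jump u K σ := by
  classical
  have hcell {L} (hL : L ∈ D.cellsOf σ) : L ∈ D.cells := (D.mem_cellsOf.1 hL).1
  have hzero {w} (hw : ∀ L ∈ D.cells, w ∈ L → L ∈ D.cellsOf σ) (hw' : ∀ L ∈ D.cellsOf σ, w ∉ L) :
      D.stepFun u w = 0 := D.stepFun_of_notMem u fun L hL hwL => hw' L (hw L hL hwL) hwL
  obtain h | ⟨L, hKL, h⟩ := D.cellsOf_eq_singleton_or_pair hK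
  · rw [D.jump_boundary u h]
    have hval {w} (hw : ∀ L ∈ D.cells, w ∈ L → L ∈ D.cellsOf σ) :
        D.stepFun u w = if w ∈ K then D.cellValue u K else 0 := by
      split_ifs with hwK
      · exact D.stepFun_of_mem u (hcell hK) hwK
      · exact hzero hw (by simpa [h] using hwK)
    rw [hval hx, hval hz]
    split_ifs <;> simp
  · rw [D.jump_interior u hKL h]
    have hL : L ∈ D.cellsOf σ := by simp [h]
    have hdisj := disjoint_left.1 (D.cell_disjoint K (hcell hK) L (hcell hL) hKL)
    obtain ⟨hxK, hzL⟩ | ⟨hzK, hxL⟩ : (x ∈ K ∧ z ∈ L) ∨ (z ∈ K ∧ x ∈ L) :=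
      (hxz K hK).imp (fun hxK => ⟨hxK, (hxz L hL).resolve_left (hdisj hxK)⟩)
        fun hzK => ⟨hzK, (hxz L hL).resolve_right (hdisj hzK)⟩
    · rw [D.stepFun_of_mem u (hcell hK) hxK, D.stepFun_of_mem u (hcell hL) hzL]
    · rw [D.stepFun_of_mem u (hcell hK) hzK, D.stepFun_of_mem u (hcell hL) hxL, abs_sub_comm]

theorem edgeDist_pos (hσ : σ ∈ D.edges) : 0 < D.edgeDist σ :=
  Finset.sum_pos (fun _ hK => D.dist_pos_of_mem_cellsOf hK) (D.cellsOf_nonempty hσ)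

/-- The jump `D_σ u` across the edge `σ`, written as the average of its values `D.jump u K σ`,
`K ∈ M_σ`, with the weights `d_{K,σ} / d_σ`: in this form, sums over the edges turn into the sums
over the control volumes and their edges that define the discrete norms. -/
noncomputable def edgeJump (σ : Set (EuclideanSpace ℝ (Fin d))) : ℝ :=
  ∑ K ∈ D.cellsOf σ, D.dist K σ * (D.jump u K σ / D.edgeDist σ)

theorem le_edgeJump {c : ℝ} (hσ : σ ∈ D.edges) (h : ∀ K ∈ D.cellsOf σ, c ≤ D.jump u K σ) :
    c ≤ D.edgeJump u σ :=
  calc c = ∑ K ∈ D.cellsOf σ, D.dist K σ * (c / D.edgeDist σ) := by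
        rw [← Finset.sum_mul, ← edgeDist, mul_div_cancel₀ c (D.edgeDist_pos hσ).ne']
    _ ≤ D.edgeJump u σ := Finset.sum_le_sum fun K hK => by
        have := D.dist_pos_of_mem_cellsOf hK
        have := D.edgeDist_pos hσ
        have := h K hK
        gcongr

theorem edgeJump_nonneg (hσ : σ ∈ D.edges) : 0 ≤ D.edgeJump u σ :=
  D.le_edgeJump u hσ fun _ _ => abs_nonneg _

theorem edgeJump_le {c : ℝ} (hσ : σ ∈ D.edges) (h : ∀ K ∈ D.cellsOf σ, D.jump u K σ ≤ c) :
    D.edgeJump u σ ≤ c :=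
  calc D.edgeJump u σ ≤ ∑ K ∈ D.cellsOf σ, D.dist K σ * (c / D.edgeDist σ) :=
        Finset.sum_le_sum fun K hK => by
          have := D.dist_pos_of_mem_cellsOf hK
          have := D.edgeDist_pos hσ
          have := h K hK
          gcongr
    _ = c := by rw [← Finset.sum_mul, ← edgeDist, mul_div_cancel₀ c (D.edgeDist_pos hσ).ne']

theorem sum_edges_cellsOf
    (f : Set (EuclideanSpace ℝ (Fin d)) → Set (EuclideanSpace ℝ (Fin d)) → ℝ) :
    ∑ σ ∈ D.edges, ∑ K ∈ D.cellsOf σ, f K σ = ∑ K ∈ D.cells, ∑ σ ∈ D.edgesOf K, f K σ := by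
  refine Finset.sum_comm' fun σ K => ?_
  rw [mem_cellsOf]
  exact ⟨fun h => ⟨h.2.2, h.2.1⟩, fun h => ⟨D.edgesOf_subset K h.2 h.1, h.2, h.1⟩⟩

theorem discreteNorm_one_eq :
    D.discreteNorm 1 u = ∑ σ ∈ D.edges, (surfaceMeasure d).real σ * D.edgeJump u σ := by
  simp only [discreteNorm, Real.rpow_one, div_one, edgeJump, Finset.mul_sum, mul_assoc,
    sum_edges_cellsOf]

theorem exists_ball_abs_stepFun_sub_le_edgeJump {n : EuclideanSpace ℝ (Fin d)} {a : ℝ}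
    (hn : ‖n‖ = 1) (hspan : (affineSpan ℝ σ : Set (EuclideanSpace ℝ (Fin d))) = {x | ⟪n, x⟫ = a})
    (hσ : σ ∈ D.edges) (hy : y ∈ σ) (hreg : y ∉ D.ridges) :
    ∃ r > 0, ∀ x ∈ Metric.ball y r, ∀ z ∈ Metric.ball y r,
      (⟪n, x⟫ - a) * (⟪n, z⟫ - a) < 0 → |D.stepFun u x - D.stepFun u z| ≤ D.edgeJump u σ := by
  obtain ⟨r, hr, hball⟩ := Metric.eventually_nhds_iff_ball.1 <|
    (D.eventually_mem_skeleton_imp_mem_affineSpan hσ hy hreg).and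
      (D.eventually_mem_cell_imp_mem_cellsOf hσ hy hreg)
  have hskel w (hw : w ∈ Metric.ball y r) (hmem : w ∈ D.skeleton) : ⟪n, w⟫ = a :=
    (hspan ▸ (hball w hw).1 hmem : w ∈ {x | ⟪n, x⟫ = a})
  refine ⟨r, hr, fun x hx z hz hxz => D.le_edgeJump u hσ fun K hK => ?_⟩
  exact D.abs_stepFun_sub_le_jump u (hball x hx).2 (hball z hz).2 (fun L hL =>
    D.mem_or_mem_of_opposite_sides hn (D.mem_cellsOf.1 hL).1
      (D.mem_closure_of_mem_cellsOf hy hL) hskel hx hz hxz) hK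

theorem eventually_dist_stepFun_le_edgeJump {t : ℝ} (hσ : σ ∈ D.edges)
    (hx : x ∉ affineSpan ℝ σ) (hσt : x + t • h ∈ σ) (hreg : x + t • h ∉ D.ridges) :
    ∀ᶠ s in 𝓝[<] t, ∀ᶠ s' in 𝓝[>] t,
      Dist.dist (D.stepFun u (x + s • h)) (D.stepFun u (x + s' • h)) ≤ D.edgeJump u σ := by
  obtain ⟨n, a, hn, hspan⟩ := D.exists_unit_normal_edge hσ
  rw [← SetLike.mem_coe, hspan, mem_ofPred_eq] at hx
  have hmem : x + t • h ∈ {x | ⟪n, x⟫ = a} := hspan ▸ subset_affineSpan ℝ σ hσt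
  rw [mem_ofPred_eq, inner_add_right, real_inner_smul_right] at hmem
  have hnh : ⟪n, h⟫ ≠ 0 := fun h0 => hx (by simpa [h0] using hmem)
  obtain ⟨r, hr, hjump⟩ := D.exists_ball_abs_stepFun_sub_le_edgeJump u hn hspan hσ hσt hreg
  have hnear : ∀ᶠ s in 𝓝 t, x + s • h ∈ Metric.ball (x + t • h) r :=
    (by fun_prop : Continuous fun s : ℝ => x + s • h).continuousAt (Metric.ball_mem_nhds _ hr)
  filter_upwards [hnear.filter_mono nhdsWithin_le_nhds, self_mem_nhdsWithin] with s hs hst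
  filter_upwards [hnear.filter_mono nhdsWithin_le_nhds, self_mem_nhdsWithin] with s' hs' hts'
  refine hjump _ hs _ hs' ?_
  have hside v : ⟪n, x + v • h⟫ - a = (v - t) * ⟪n, h⟫ := by
    rw [inner_add_right, real_inner_smul_right]
    linarith
  rw [hside, hside, mul_mul_mul_comm]
  exact mul_neg_of_neg_of_pos (mul_neg_of_neg_of_pos (sub_neg.2 hst) (sub_pos.2 hts'))
    (mul_self_pos.2 hnh)

open Classical in
theorem abs_stepFun_add_sub_le (hx : ∀ σ ∈ D.edges, x ∉ affineSpan ℝ σ)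
    (hxh : x + h ∉ D.skeleton) (hreg : ∀ t ∈ Ioo (0 : ℝ) 1, x + t • h ∉ D.ridges) :
    |D.stepFun u (x + h) - D.stepFun u x| ≤
      ∑ σ ∈ D.edges with ∃ t ∈ Ioo (0 : ℝ) 1, x + t • h ∈ σ, D.edgeJump u σ := by
  set A := D.edges.filter fun σ => ∃ t ∈ Ioo (0 : ℝ) 1, x + t • h ∈ σ
  have hedge {σ} (hσ : σ ∈ A) : σ ∈ D.edges := (Finset.mem_filter.1 hσ).1
  choose! τ hτ hτσ using fun σ (hσ : σ ∈ A) => (Finset.mem_filter.1 hσ).2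
  have hcross {σ t} (hσ : σ ∈ D.edges) (ht : t ∈ Icc (0 : ℝ) 1) (htσ : x + t • h ∈ closure σ) :
      σ ∈ A ∧ τ σ = t := by
    have ht0 : 0 ≠ t := by
      rintro rfl
      exact hx σ hσ (closure_subset_affineSpan (by simpa using htσ))
    have ht1 : t ≠ 1 := by
      rintro rfl
      exact hxh (mem_biUnion hσ (by simpa using htσ))
    have htIoo : t ∈ Ioo (0 : ℝ) 1 := ⟨ht.1.lt_of_ne ht0, ht.2.lt_of_ne ht1⟩
    have hmem : x + t • h ∈ σ := by_contra fun hn => hreg t htIoo (mem_biUnion hσ ⟨htσ, hn⟩)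
    have hσA : σ ∈ A := Finset.mem_filter.2 ⟨hσ, t, htIoo, hmem⟩
    exact ⟨hσA, eq_of_add_smul_mem_of_notMem (hx σ hσ)
      (subset_affineSpan ℝ σ (hτσ σ hσA)) (subset_affineSpan ℝ σ hmem)⟩
  have hinj : InjOn τ A := fun σ hσ σ' hσ' heq => by_contra fun hne =>
    disjoint_left.1 (D.edge_disjoint σ (hedge hσ) σ' (hedge hσ') hne) (hτσ σ hσ)
      (heq ▸ hτσ σ' hσ')
  have hconst s t (hs : 0 ≤ s) (hst : s ≤ t) (ht : t ≤ 1) (hAst : ∀ σ ∈ A, τ σ ∉ Icc s t) :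
      D.stepFun u (x + s • h) = D.stepFun u (x + t • h) := by
    refine D.stepFun_eq_of_isPreconnected u
      (isPreconnected_Icc.image (fun r : ℝ => x + r • h) (by fun_prop)) ?_
      (mem_image_of_mem _ (left_mem_Icc.2 hst)) (mem_image_of_mem _ (right_mem_Icc.2 hst))
    rw [disjoint_left, forall_mem_image]
    intro r hr hmem
    obtain ⟨σ, hσ, hrσ⟩ := mem_iUnion₂.1 hmem
    obtain ⟨hσA, rfl⟩ := hcross hσ ⟨hs.trans hr.1, hr.2.trans ht⟩ hrσ
    exact hAst σ hσA hr
  have hjump := dist_le_sum_of_jumps zero_le_one hinj hτ hconst fun σ hσ =>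
    D.eventually_dist_stepFun_le_edgeJump u (hedge hσ) (hx σ (hedge hσ)) (hτσ σ hσ)
      (hreg _ (hτ σ hσ))
  rw [abs_sub_comm]
  simpa [Real.dist_eq] using hjump

theorem ae_add_smul_notMem_ridges (h : EuclideanSpace ℝ (Fin d)) :
    ∀ᵐ x, ∀ t ∈ Ioo (0 : ℝ) 1, x + t • h ∉ D.ridges := by
  have hσ : ∀ᵐ x, ∀ σ ∈ D.edges, x ∉ ⋃ t ∈ Ioo (0 : ℝ) 1, (· + t • h) ⁻¹' (closure σ \ σ) := by
    refine (eventually_all_finset D.edges).2 fun σ hσ => measure_eq_zero_iff_ae_notMem.1 ?_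
    obtain ⟨n, a, hn, hspan⟩ := D.exists_unit_normal_edge hσ
    rw [volume_sweep hn (measurableSet_closure.diff (D.measurableSet_edge hσ))
      (sdiff_subset.trans (hspan ▸ closure_subset_affineSpan)), ← surfaceMeasure_eq,
      D.edge_boundary_null σ hσ, mul_zero]
  filter_upwards [hσ] with x hx t ht hmem
  obtain ⟨σ, hσ, hxσ⟩ := mem_iUnion₂.1 hmem
  exact hx σ hσ (mem_biUnion ht hxσ)

open Classical in
theorem ae_abs_stepFun_add_sub_le (h : EuclideanSpace ℝ (Fin d)) :
    ∀ᵐ x, |D.stepFun u (x + h) - D.stepFun u x| ≤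
      ∑ σ ∈ D.edges with ∃ t ∈ Ioo (0 : ℝ) 1, x + t • h ∈ σ, D.edgeJump u σ := by
  have hplanes : ∀ᵐ x, ∀ σ ∈ D.edges, x ∉ affineSpan ℝ σ := by
    refine (eventually_all_finset D.edges).2 fun σ hσ => ?_
    obtain ⟨n, a, hn, hspan⟩ := D.exists_unit_normal_edge hσ
    simp only [← SetLike.mem_coe, hspan]
    exact measure_eq_zero_iff_ae_notMem.1 (volume_hyperplane hn a)
  have hshift : ∀ᵐ x, x + h ∉ D.skeleton :=
    (measurePreserving_add_right volume h).quasiMeasurePreserving.ae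
      (measure_eq_zero_iff_ae_notMem.1 D.volume_skeleton)
  filter_upwards [hplanes, hshift, D.ae_add_smul_notMem_ridges h] with x hx hxh hreg
  exact D.abs_stepFun_add_sub_le u hx hxh hreg

theorem volume_sweep_edge_le (hb : Bornology.IsBounded Ω) (hσ : σ ∈ D.edges)
    (h : EuclideanSpace ℝ (Fin d)) :
    volume (⋃ t ∈ Ioo (0 : ℝ) 1, (· + t • h) ⁻¹' σ) ≤
      ENNReal.ofReal (‖h‖ * (surfaceMeasure d).real σ) := by
  obtain ⟨n, a, hn, hspan⟩ := D.exists_unit_normal_edge hσ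
  rw [volume_sweep hn (D.measurableSet_edge hσ) (hspan ▸ subset_affineSpan ℝ σ),
    ← surfaceMeasure_eq, ENNReal.ofReal_mul (norm_nonneg h), ofReal_norm,
    ofReal_measureReal (D.surfaceMeasure_edge_lt_top hb hσ).ne]
  gcongr
  rw [enorm_le_iff_norm_le]
  simpa [hn] using norm_inner_le_norm (𝕜 := ℝ) n h

theorem lintegral_stepFun_add_sub_le (hb : Bornology.IsBounded Ω)
    (h : EuclideanSpace ℝ (Fin d)) :
    ∫⁻ x, ‖D.stepFun u (x + h) - D.stepFun u x‖ₑ ≤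
      ENNReal.ofReal (‖h‖ * D.discreteNorm 1 u) := by
  classical
  set S : Set (EuclideanSpace ℝ (Fin d)) → Set (EuclideanSpace ℝ (Fin d)) := fun σ =>
    toMeasurable volume (⋃ t ∈ Ioo (0 : ℝ) 1, (· + t • h) ⁻¹' σ)
  have hpoint : ∀ᵐ x, ‖D.stepFun u (x + h) - D.stepFun u x‖ₑ ≤
      ∑ σ ∈ D.edges, (S σ).indicator (fun _ => ENNReal.ofReal (D.edgeJump u σ)) x := by
    filter_upwards [D.ae_abs_stepFun_add_sub_le u h] with x hx
    rw [Real.enorm_eq_ofReal_abs]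
    refine (ENNReal.ofReal_le_ofReal hx).trans ?_
    rw [ENNReal.ofReal_sum_of_nonneg fun σ hσ =>
      D.edgeJump_nonneg u (Finset.mem_filter.1 hσ).1, Finset.sum_filter]
    refine Finset.sum_le_sum fun σ _ => ?_
    split_ifs with hσ
    · have hxS : x ∈ S σ := subset_toMeasurable _ _ (by simpa using hσ)
      rw [indicator_of_mem hxS]
    · exact zero_le
  calc ∫⁻ x, ‖D.stepFun u (x + h) - D.stepFun u x‖ₑ
      ≤ ∫⁻ x, ∑ σ ∈ D.edges, (S σ).indicator (fun _ => ENNReal.ofReal (D.edgeJump u σ)) x :=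
        lintegral_mono_ae hpoint
    _ = ∑ σ ∈ D.edges, ENNReal.ofReal (D.edgeJump u σ) *
          volume (⋃ t ∈ Ioo (0 : ℝ) 1, (· + t • h) ⁻¹' σ) := by
        rw [lintegral_finsetSum _ fun σ _ =>
          measurable_const.indicator (measurableSet_toMeasurable _ _)]
        simp only [lintegral_indicator_const (measurableSet_toMeasurable _ _),
          measure_toMeasurable]
    _ ≤ ∑ σ ∈ D.edges, ENNReal.ofReal (D.edgeJump u σ) *
          ENNReal.ofReal (‖h‖ * (surfaceMeasure d).real σ) := by
        gcongr with σ hσ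
        exact D.volume_sweep_edge_le hb hσ h
    _ = ENNReal.ofReal (‖h‖ * D.discreteNorm 1 u) := by
        rw [discreteNorm_one_eq, Finset.mul_sum, ENNReal.ofReal_sum_of_nonneg fun σ hσ =>
          mul_nonneg (norm_nonneg h) (mul_nonneg measureReal_nonneg (D.edgeJump_nonneg u hσ))]
        refine Finset.sum_congr rfl fun σ hσ => ?_
        rw [← ENNReal.ofReal_mul (D.edgeJump_nonneg u hσ)]
        ring_nf

theorem volume_cell_lt_top (hb : Bornology.IsBounded Ω) (hK : K ∈ D.cells) : volume K < ∞ :=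
  (hb.subset (D.cell_subset K hK)).measure_lt_top

theorem stepFun_of_notMem_domain {x : EuclideanSpace ℝ (Fin d)} (hx : x ∉ Ω) :
    D.stepFun u x = 0 :=
  D.stepFun_of_notMem u fun K hK hxK => hx (D.cell_subset K hK hxK)

theorem memLp_stepFun (hb : Bornology.IsBounded Ω) (p : ℝ≥0∞) : MemLp (D.stepFun u) p :=
  memLp_finsetSum _ fun K hK => memLp_indicator_const p (D.cell_isOpen K hK).measurableSet _
    (.inr (D.volume_cell_lt_top hb hK).ne)

theorem lintegral_enorm_stepFun (hb : Bornology.IsBounded Ω) :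
    ∫⁻ x, ‖D.stepFun u x‖ₑ =
      ENNReal.ofReal (∑ K ∈ D.cells, volume.real K * |D.cellValue u K|) := by
  have hK : ∀ K ∈ D.cells, Integrable (K.indicator fun _ => |D.cellValue u K|) := fun K hK =>
    (integrable_indicator_iff (D.cell_isOpen K hK).measurableSet).2
      (integrableOn_const (D.volume_cell_lt_top hb hK).ne)
  rw [← ofReal_integral_norm_eq_lintegral_enorm
    (memLp_one_iff_integrable.1 (D.memLp_stepFun u hb 1))]
  have habs : (fun x => ‖D.stepFun u x‖) = D.stepFun (abs ∘ u) := by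
    rw [D.stepFun_comp u abs_zero]
    rfl
  rw [habs]
  congr 1
  refine (integral_finsetSum D.cells hK).trans (Finset.sum_congr rfl fun K hK => ?_)
  rw [integral_indicator_const _ (D.cell_isOpen K hK).measurableSet, smul_eq_mul]

theorem sum_volume_mul_abs_le (hd : 1 ≤ d) {R : ℝ} (hΩ : Ω ⊆ Metric.ball 0 R) (hR : 0 ≤ R) :
    ∑ K ∈ D.cells, volume.real K * |D.cellValue u K| ≤ 2 * R * D.discreteNorm 1 u := by
  have hb : Bornology.IsBounded Ω := Metric.isBounded_ball.subset hΩ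
  have : Nonempty (Fin d) := ⟨⟨0, hd⟩⟩
  -- A shift by `2 * R` moves `Ω` off itself, so the translation estimate bounds the `L¹` norm.
  obtain ⟨h, hh⟩ := exists_norm_eq (EuclideanSpace ℝ (Fin d)) (c := 2 * R) (by positivity)
  have hoff {x} (hx : x ∈ Ω) : x + h ∉ Ω := fun hxh => by
    have hxR := mem_ball_zero_iff.1 (hΩ hx)
    have hxhR := mem_ball_zero_iff.1 (hΩ hxh)
    have htri := norm_sub_le (x + h) x
    rw [add_sub_cancel_left, hh] at htri
    linarith
  have hnorm : 0 ≤ D.discreteNorm 1 u := by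
    rw [discreteNorm_one_eq]
    exact Finset.sum_nonneg fun σ hσ => mul_nonneg measureReal_nonneg (D.edgeJump_nonneg u hσ)
  rw [← ENNReal.ofReal_le_ofReal_iff (by positivity), ← D.lintegral_enorm_stepFun u hb, ← hh]
  refine (lintegral_mono fun x => ?_).trans (D.lintegral_stepFun_add_sub_le u hb h)
  by_cases hx : x ∈ Ω
  · rw [D.stepFun_of_notMem_domain u (hoff hx), zero_sub, enorm_neg]
  · rw [D.stepFun_of_notMem_domain u hx, enorm_zero]
    exact zero_le

theorem exists_mem_cell {x : EuclideanSpace ℝ (Fin d)} (hx : x ∈ Ω) (hreg : x ∉ D.skeleton) :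
    ∃ K ∈ D.cells, x ∈ K := by
  obtain ⟨K, hK, hxK⟩ := mem_iUnion₂.1 (D.closure_eq ▸ subset_closure hx)
  exact ⟨K, hK, by_contra fun hn => hreg <|
    D.frontier_cell_subset_skeleton hK ((D.cell_isOpen K hK).frontier_eq ▸ ⟨hxK, hn⟩)⟩

include D in
theorem nullMeasurableSet_domain : NullMeasurableSet Ω := by
  have hΩ : Ω = (⋃ K ∈ D.cells, K) ∪ Ω ∩ D.skeleton := by
    refine Subset.antisymm (fun x hx => ?_)
      (union_subset (iUnion₂_subset D.cell_subset) inter_subset_left)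
    by_cases hreg : x ∈ D.skeleton
    · exact .inr ⟨hx, hreg⟩
    · exact .inl (mem_iUnion₂.2 (by simpa using D.exists_mem_cell hx hreg))
  rw [hΩ]
  exact (isOpen_biUnion D.cell_isOpen).measurableSet.nullMeasurableSet.union
    (.of_null (measure_mono_null inter_subset_right D.volume_skeleton))

theorem PiecewiseConstant.ae_restrict_eq_stepFun {D : SpaceDiscretisation Ω}
    {u : EuclideanSpace ℝ (Fin d) → ℝ} (hu : D.PiecewiseConstant u) :
    u =ᵐ[volume.restrict Ω] D.stepFun u := by
  filter_upwards [ae_restrict_mem₀ D.nullMeasurableSet_domain,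
    ae_restrict_of_ae (measure_eq_zero_iff_ae_notMem.1 D.volume_skeleton)] with x hxΩ hreg
  obtain ⟨K, hK, hxK⟩ := D.exists_mem_cell hxΩ hreg
  obtain ⟨c, hc⟩ := hu K hK
  rw [D.stepFun_of_mem u hK hxK, cellValue, hc x hxK, hc _ (D.point_mem K hK)]

theorem PiecewiseConstant.indicator_ae_eq_stepFun {D : SpaceDiscretisation Ω}
    {u : EuclideanSpace ℝ (Fin d) → ℝ} (hu : D.PiecewiseConstant u) :
    Ω.indicator u =ᵐ[volume] D.stepFun u := by
  filter_upwards [ae_imp_of_ae_restrict hu.ae_restrict_eq_stepFun] with x hx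
  by_cases hxΩ : x ∈ Ω
  · rw [indicator_of_mem hxΩ, hx hxΩ]
  · rw [indicator_of_notMem hxΩ, D.stepFun_of_notMem_domain u hxΩ]

end SpaceDiscretisation

/-- The odd extension of `t ↦ t ^ p`. -/
noncomputable def signedPow (p t : ℝ) : ℝ := t * |t| ^ (p - 1)

theorem mul_rpow_sub_one_self {p x : ℝ} (hp : p ≠ 0) (hx : 0 ≤ x) : x * x ^ (p - 1) = x ^ p := by
  rw [← Real.rpow_one_add' hx (by simpa), add_sub_cancel]

theorem signedPow_zero (p : ℝ) : signedPow p 0 = 0 := by simp [signedPow]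

theorem signedPow_neg (p t : ℝ) : signedPow p (-t) = -signedPow p t := by simp [signedPow]

theorem abs_signedPow {p : ℝ} (hp : p ≠ 0) (t : ℝ) : |signedPow p t| = |t| ^ p := by
  rw [signedPow, abs_mul, abs_of_nonneg (Real.rpow_nonneg (abs_nonneg t) _),
    mul_rpow_sub_one_self hp (abs_nonneg t)]

theorem rpow_sub_rpow_le {p x y : ℝ} (hp : 1 ≤ p) (hy : 0 ≤ y) (hyx : y ≤ x) :
    x ^ p - y ^ p ≤ p * x ^ (p - 1) * (x - y) := by
  rcases (hy.trans hyx).eq_or_lt with rfl | hx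
  · have : y = 0 := le_antisymm hyx hy
    simp [this]
  have hbernoulli := one_add_mul_self_le_rpow_one_add (s := y / x - 1)
    (by have : 0 ≤ y / x := by positivity
        linarith) hp
  rw [add_sub_cancel, Real.div_rpow hy hx.le, le_div_iff₀ (by positivity)] at hbernoulli
  have htangent : (1 + p * (y / x - 1)) * x ^ p = x ^ p - p * x ^ (p - 1) * (x - y) := by
    rw [← mul_rpow_sub_one_self (by positivity) hx.le]
    field_simp
    ring
  linarith

theorem abs_signedPow_sub_le {p : ℝ} (hp : 1 ≤ p) (a b : ℝ) :
    |signedPow p a - signedPow p b| ≤ p * (|a| ^ (p - 1) + |b| ^ (p - 1)) * |a - b| := by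
  wlog hba : |b| ≤ |a| generalizing a b
  · rw [abs_sub_comm, add_comm (|a| ^ _), abs_sub_comm a]
    exact this b a (le_of_not_ge hba)
  have hsplit : signedPow p a - signedPow p b =
      |a| ^ (p - 1) * (a - b) + b * (|a| ^ (p - 1) - |b| ^ (p - 1)) := by
    rw [signedPow, signedPow]
    ring
  have hmono : |b| ^ (p - 1) ≤ |a| ^ (p - 1) :=
    Real.rpow_le_rpow (abs_nonneg b) hba (by linarith)
  have ha0 : 0 ≤ |a| ^ (p - 1) := by positivity
  have hsecond : |b| * (|a| ^ (p - 1) - |b| ^ (p - 1)) ≤ (p - 1) * |a| ^ (p - 1) * |a - b| := by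
    have hpow := rpow_sub_rpow_le hp (abs_nonneg b) hba
    have hb := mul_rpow_sub_one_self (by positivity) (abs_nonneg b)
    have ha := mul_rpow_sub_one_self (by positivity) (abs_nonneg a)
    have hsub := abs_sub_abs_le_abs_sub a b
    calc |b| * (|a| ^ (p - 1) - |b| ^ (p - 1)) ≤ (p - 1) * |a| ^ (p - 1) * (|a| - |b|) := by
          linarith
      _ ≤ _ := by
          have : 0 ≤ p - 1 := by linarith
          gcongr
  rw [hsplit]
  refine (abs_add_le _ _).trans ?_
  rw [abs_mul, abs_mul, abs_of_nonneg ha0, abs_of_nonneg (sub_nonneg.2 hmono)]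
  have hnonneg : 0 ≤ p * |b| ^ (p - 1) * |a - b| := by positivity
  linarith

theorem abs_sub_rpow_le_signedPow {p : ℝ} (hp : 1 ≤ p) (a b : ℝ) :
    |a - b| ^ p ≤ 2 ^ p * |signedPow p a - signedPow p b| := by
  wlog hba : |b| ≤ |a| generalizing a b
  · rw [abs_sub_comm, abs_sub_comm (signedPow p a)]
    exact this b a (le_of_not_ge hba)
  wlog ha : 0 ≤ a generalizing a b
  · have := this (-a) (-b) (by simpa using hba) (by linarith)
    rw [signedPow_neg, signedPow_neg, neg_sub_neg, neg_sub_neg, abs_sub_comm,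
      abs_sub_comm (signedPow p b)] at this
    exact this
  rw [abs_of_nonneg ha] at hba
  have hb := abs_le.1 hba
  have hq : 0 ≤ p - 1 := by linarith
  have haq : 0 ≤ a ^ (p - 1) := by positivity
  have hmono : |b| ^ (p - 1) ≤ a ^ (p - 1) := Real.rpow_le_rpow (abs_nonneg b) hba hq
  have hbq : 0 ≤ |b| ^ (p - 1) := by positivity
  have hlow : a ^ (p - 1) * (a - b) ≤ 2 * (signedPow p a - signedPow p b) := by
    rw [signedPow, signedPow, abs_of_nonneg ha]
    rcases le_total 0 b with h | h
    · nlinarith [mul_le_mul_of_nonneg_left hmono h, mul_nonneg haq (sub_nonneg.2 hb.2)]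
    · nlinarith [mul_nonneg haq (by linarith : 0 ≤ a + b), mul_nonneg hbq (neg_nonneg.2 h)]
  have hab : 0 ≤ a - b := by linarith
  rw [abs_of_nonneg hab, ← mul_rpow_sub_one_self (by positivity) hab,
    ← mul_rpow_sub_one_self (by positivity) zero_le_two]
  calc (a - b) * (a - b) ^ (p - 1) ≤ (a - b) * (2 * a) ^ (p - 1) := by
        gcongr
        linarith
    _ = 2 ^ (p - 1) * (a ^ (p - 1) * (a - b)) := by
        rw [Real.mul_rpow zero_le_two ha]
        ring
    _ ≤ 2 ^ (p - 1) * (2 * (signedPow p a - signedPow p b)) := by gcongr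
    _ ≤ 2 ^ (p - 1) * (2 * |signedPow p a - signedPow p b|) := by
        gcongr
        exact le_abs_self _
    _ = _ := by ring

theorem mul_rpow_sub_one_le {p a b ε : ℝ} (hp : 1 ≤ p) (ha : 0 ≤ a) (hb : 0 ≤ b) (hε : 0 < ε) :
    a * b ^ (p - 1) ≤ ε * b ^ p + ε ^ (1 - p) * a ^ p := by
  have hp0 : p ≠ 0 := by positivity
  have : 0 ≤ p - 1 := by linarith
  rcases le_total a (ε * b) with h | h
  · calc a * b ^ (p - 1) ≤ ε * b * b ^ (p - 1) := by gcongr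
      _ = ε * b ^ p := by rw [mul_assoc, mul_rpow_sub_one_self hp0 hb]
      _ ≤ _ := le_add_of_nonneg_right (by positivity)
  · have h1 : b ≤ ε⁻¹ * a := by
      rw [inv_mul_eq_div, le_div_iff₀ hε]
      linarith
    calc a * b ^ (p - 1) ≤ a * (ε⁻¹ * a) ^ (p - 1) := by gcongr
      _ = ε ^ (1 - p) * a ^ p := by
        rw [Real.mul_rpow (by positivity) ha, Real.inv_rpow hε.le, ← Real.rpow_neg hε.le, neg_sub,
          ← mul_rpow_sub_one_self hp0 ha]
        ring
      _ ≤ _ := le_add_of_nonneg_left (by positivity)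

namespace SpaceDiscretisation

variable {d : ℕ} {Ω : Set (EuclideanSpace ℝ (Fin d))} {D : SpaceDiscretisation Ω}
  {K σ : Set (EuclideanSpace ℝ (Fin d))} {u : EuclideanSpace ℝ (Fin d) → ℝ} {p η C : ℝ}

theorem RatioBound.edgeDist_le (hD : D.RatioBound η) (hη : 0 < η) (hσ : σ ∈ D.edges)
    (hK : K ∈ D.cellsOf σ) : D.edgeDist σ ≤ (1 + 1 / η) * D.dist K σ := by
  classical
  have hKpos := D.dist_pos_of_mem_cellsOf hK
  rw [add_mul, one_mul]
  obtain h | ⟨L, hKL, h⟩ := D.cellsOf_eq_singleton_or_pair hK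
  · rw [edgeDist, h, Finset.sum_singleton]
    exact le_add_of_nonneg_right (by positivity)
  · rw [edgeDist, h, Finset.sum_pair hKL]
    gcongr
    exact (div_le_iff₀ hKpos).1 (hD σ hσ L (by simp [h]) K hK hKL.symm).2

theorem jump_nonneg : 0 ≤ D.jump u K σ := abs_nonneg _

theorem jump_signedPow_comp_le (hp : 1 ≤ p) (hK : K ∈ D.cellsOf σ) :
    D.jump (signedPow p ∘ u) K σ ≤
      ∑ L ∈ D.cellsOf σ, p * (|D.cellValue u L| ^ (p - 1) * D.jump u L σ) := by
  classical
  have hval L : D.cellValue (signedPow p ∘ u) L = signedPow p (D.cellValue u L) := rfl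
  obtain h | ⟨L, hKL, h⟩ := D.cellsOf_eq_singleton_or_pair hK
  · rw [h, Finset.sum_singleton, D.jump_boundary _ h, D.jump_boundary _ h, hval,
      abs_signedPow (by positivity), mul_comm (|_| ^ _),
      mul_rpow_sub_one_self (by positivity) (abs_nonneg _)]
    exact le_mul_of_one_le_left (by positivity) hp
  · have h' : D.cellsOf σ = {L, K} := by rw [h, Finset.pair_comm]
    rw [h, Finset.sum_pair hKL, D.jump_interior _ hKL h, D.jump_interior _ hKL h,
      D.jump_interior _ hKL.symm h', abs_sub_comm (D.cellValue u L), hval, hval]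
    refine (abs_signedPow_sub_le hp _ _).trans_eq ?_
    ring

theorem sum_energy_le (hp : 0 < p) (hC : D.discreteNorm p u ≤ C) :
    ∑ K ∈ D.cells, ∑ σ ∈ D.edgesOf K,
      (surfaceMeasure d).real σ * D.dist K σ * (D.jump u K σ / D.edgeDist σ) ^ p ≤ |C| ^ p := by
  refine (Real.rpow_inv_le_iff_of_pos ?_ (abs_nonneg C) hp).1 ?_
  · refine Finset.sum_nonneg fun K hK => Finset.sum_nonneg fun σ hσ => ?_
    have := D.dist_pos K hK σ hσ
    have := D.edgeDist_pos (D.edgesOf_subset K hK hσ)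
    have := D.jump_nonneg (u := u) (K := K) (σ := σ)
    have := D.dist_pos_of_mem_cellsOf (D.mem_cellsOf.2 ⟨hK, hσ⟩)
    positivity
  · rw [← one_div]
    exact hC.trans (le_abs_self C)

theorem RatioBound.mul_jump_le (hD : D.RatioBound η) (hη : 0 < η) (hp : 1 ≤ p) {ε : ℝ}
    (hε : 0 < ε) (hK : K ∈ D.cells) (hσ : σ ∈ D.edgesOf K) :
    |D.cellValue u K| ^ (p - 1) * D.jump u K σ ≤ (1 + 1 / η) * D.dist K σ *
      (ε * |D.cellValue u K| ^ p + ε ^ (1 - p) * (D.jump u K σ / D.edgeDist σ) ^ p) := by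
  have hKσ := D.mem_cellsOf.2 ⟨hK, hσ⟩
  have hσE := D.edgesOf_subset K hK hσ
  have hdist := D.dist_pos_of_mem_cellsOf hKσ
  have hedge := D.edgeDist_pos hσE
  have hjump : 0 ≤ D.jump u K σ / D.edgeDist σ := div_nonneg jump_nonneg hedge.le
  calc |D.cellValue u K| ^ (p - 1) * D.jump u K σ
      = D.edgeDist σ * (D.jump u K σ / D.edgeDist σ * |D.cellValue u K| ^ (p - 1)) := by
        field_simp
    _ ≤ (1 + 1 / η) * D.dist K σ *
          (ε * |D.cellValue u K| ^ p + ε ^ (1 - p) * (D.jump u K σ / D.edgeDist σ) ^ p) := by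
        gcongr
        · exact hD.edgeDist_le hη hσE hKσ
        · exact mul_rpow_sub_one_le hp hjump (abs_nonneg _) hε

theorem discreteNorm_one_signedPow_comp_le (hp : 1 ≤ p) :
    D.discreteNorm 1 (signedPow p ∘ u) ≤ p * ∑ K ∈ D.cells, ∑ σ ∈ D.edgesOf K,
      (surfaceMeasure d).real σ * (|D.cellValue u K| ^ (p - 1) * D.jump u K σ) :=
  calc D.discreteNorm 1 (signedPow p ∘ u)
      ≤ ∑ σ ∈ D.edges, (surfaceMeasure d).real σ *
          ∑ K ∈ D.cellsOf σ, p * (|D.cellValue u K| ^ (p - 1) * D.jump u K σ) := by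
        rw [discreteNorm_one_eq]
        gcongr with σ hσ
        exact D.edgeJump_le _ hσ fun K hK => jump_signedPow_comp_le hp hK
    _ = _ := by
        simp only [Finset.mul_sum, sum_edges_cellsOf, mul_left_comm p]

theorem RatioBound.discreteNorm_one_signedPow_comp_le_add (hD : D.RatioBound η) (hη : 0 < η)
    (hb : Bornology.IsBounded Ω) (hp : 1 ≤ p) (hC : D.discreteNorm p u ≤ C) {ε : ℝ}
    (hε : 0 < ε) :
    D.discreteNorm 1 (signedPow p ∘ u) ≤ p * (1 + 1 / η) *
      (ε * (d * ∑ K ∈ D.cells, volume.real K * |D.cellValue u K| ^ p) + ε ^ (1 - p) * |C| ^ p) := by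
  calc D.discreteNorm 1 (signedPow p ∘ u)
      ≤ p * ∑ K ∈ D.cells, ∑ σ ∈ D.edgesOf K, (surfaceMeasure d).real σ *
          ((1 + 1 / η) * D.dist K σ * (ε * |D.cellValue u K| ^ p +
            ε ^ (1 - p) * (D.jump u K σ / D.edgeDist σ) ^ p)) := by
        refine (discreteNorm_one_signedPow_comp_le hp).trans ?_
        gcongr p * ∑ K ∈ D.cells, ∑ σ ∈ D.edgesOf K, _ * ?_ with K hK σ hσ
        exact hD.mul_jump_le hη hp hε hK hσ
    _ = p * (1 + 1 / η) * (ε * (∑ K ∈ D.cells, (∑ σ ∈ D.edgesOf K,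
            (surfaceMeasure d).real σ * D.dist K σ) * |D.cellValue u K| ^ p) +
          ε ^ (1 - p) * ∑ K ∈ D.cells, ∑ σ ∈ D.edgesOf K,
            (surfaceMeasure d).real σ * D.dist K σ * (D.jump u K σ / D.edgeDist σ) ^ p) := by
        simp only [Finset.mul_sum, Finset.sum_mul, ← Finset.sum_add_distrib]
        refine Finset.sum_congr rfl fun K _ => Finset.sum_congr rfl fun σ _ => ?_
        ring
    _ ≤ _ := by
        simp only [Finset.mul_sum _ _ (d : ℝ), ← mul_assoc (d : ℝ)]
        gcongr with K hK
        · exact D.sum_surfaceMeasure_mul_dist_le hb hK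
        · exact sum_energy_le (by positivity) hC

theorem exists_forall_discreteNorm_one_signedPow_comp_le (hd : 1 ≤ d)
    (hb : Bornology.IsBounded Ω) (hp : 1 ≤ p) (hη : 0 < η) (C : ℝ) :
    ∃ V : ℝ, ∀ D : SpaceDiscretisation Ω, D.RatioBound η → ∀ u : EuclideanSpace ℝ (Fin d) → ℝ,
      D.discreteNorm p u ≤ C → D.discreteNorm 1 (signedPow p ∘ u) ≤ V := by
  obtain ⟨R, hR, hΩ⟩ := hb.subset_ball_lt 0 0
  set c := p * (1 + 1 / η)
  have hc : 0 < c := by positivity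
  set ε := (4 * R * c * d)⁻¹ with hε
  have hε0 : 0 < ε := by positivity
  refine ⟨2 * (c * (ε ^ (1 - p) * |C| ^ p)), fun D hD u hu => ?_⟩
  set V := D.discreteNorm 1 (signedPow p ∘ u)
  set N := ∑ K ∈ D.cells, volume.real K * |D.cellValue u K| ^ p with hN
  have hval K : |D.cellValue (signedPow p ∘ u) K| = |D.cellValue u K| ^ p :=
    abs_signedPow (by positivity) _
  have hPoincare : N ≤ 2 * R * V := by
    simpa only [hval] using D.sum_volume_mul_abs_le (signedPow p ∘ u) hd hΩ hR.le
  have habsorb : c * (ε * (d * N)) ≤ V / 2 :=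
    calc c * (ε * (d * N)) ≤ c * (ε * (d * (2 * R * V))) := by gcongr
      _ = V / 2 := by
        rw [hε]
        field_simp
        norm_num
  have hV := hD.discreteNorm_one_signedPow_comp_le_add hη hb hp hu hε0
  rw [← hN, mul_add] at hV
  linarith

end SpaceDiscretisation

theorem totallyBounded_range_iff {ι X : Type*} [PseudoMetricSpace X] {a : ι → X} :
    TotallyBounded (range a) ↔
      ∀ δ > 0, ∃ t : Set ι, t.Finite ∧ ∀ i, ∃ j ∈ t, dist (a i) (a j) < δ := by
  constructor
  · intro ha δ hδ
    obtain ⟨s, hs, hsfin, hcover⟩ := ha.exists_subset (Metric.dist_mem_uniformity hδ)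
    obtain ⟨t, -, ht, rfl⟩ := hsfin.exists_subset_finite_image_eq (image_univ ▸ hs)
    refine ⟨t, ht, fun i => ?_⟩
    obtain ⟨_, ⟨j, hj, rfl⟩, hij⟩ := mem_iUnion₂.1 (hcover ⟨i, rfl⟩)
    exact ⟨j, hj, hij⟩
  · intro ha
    refine Metric.totallyBounded_iff.2 fun δ hδ => ?_
    obtain ⟨t, ht, hcover⟩ := ha δ hδ
    refine ⟨a '' t, ht.image a, ?_⟩
    rintro _ ⟨i, rfl⟩
    obtain ⟨j, hj, hij⟩ := hcover i
    exact mem_biUnion (mem_image_of_mem a hj) hij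

section Kolmogorov

variable {E F : Type*} [NormedAddCommGroup E] [NormedAddCommGroup F] [MeasurableSpace E]

/-- The average over `y ∈ ball x (2 * δ)` of `‖f y - f x‖`, up to the normalisation by the volume
of the ball of radius `δ` in place of `2 * δ`. It controls the distance from `f x` to the average
of `f` over any ball of radius `δ` that contains `x`. -/
noncomputable def localOscillation (μ : Measure E) (f : E → F) (δ : ℝ) (x : E) : ℝ≥0∞ :=
  (μ (Metric.ball 0 δ))⁻¹ * ∫⁻ h in Metric.ball 0 (2 * δ), ‖f (x + h) - f x‖ₑ ∂μ

variable [BorelSpace E] {μ : Measure E} [μ.IsAddHaarMeasure] {f g : E → F} {δ : ℝ}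

theorem laverage_enorm_sub_le_localOscillation (f : E → F) {x z : E} (hx : x ∈ Metric.ball z δ) :
    ⨍⁻ y in Metric.ball z δ, ‖f x - f y‖ₑ ∂μ ≤ localOscillation μ f δ x := by
  rw [localOscillation, setLAverage_eq, ENNReal.div_eq_inv_mul, Measure.addHaar_ball_center]
  refine mul_le_mul_right ?_ _
  calc ∫⁻ y in Metric.ball z δ, ‖f x - f y‖ₑ ∂μ
      ≤ ∫⁻ y in Metric.ball x (2 * δ), ‖f y - f x‖ₑ ∂μ := by
        simp only [enorm_sub_rev (f x)]
        refine lintegral_mono_set fun y hy => ?_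
        rw [Metric.mem_ball] at *
        linarith [dist_triangle_right y x z]
    _ = ∫⁻ h in Metric.ball 0 (2 * δ), ‖f (x + h) - f x‖ₑ ∂μ := by
        rw [← lintegral_indicator measurableSet_ball, ← lintegral_indicator measurableSet_ball,
          ← lintegral_add_left_eq_self _ x]
        simp only [indicator, Metric.mem_ball, dist_self_add_left, dist_zero_right]

theorem norm_setAverage_ball_le [NormedSpace ℝ F] (hδ : 0 < δ) {I : ℝ≥0∞} (hI : I ≠ ∞)
    (hf : ∫⁻ x, ‖f x‖ₑ ∂μ ≤ I) (z : E) :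
    ‖⨍ y in Metric.ball z δ, f y ∂μ‖ ≤ ((μ (Metric.ball 0 δ))⁻¹ * I).toReal := by
  have hB0 : μ (Metric.ball 0 δ) ≠ 0 := (Metric.measure_ball_pos μ _ hδ).ne'
  refine (toReal_enorm _).symm.trans_le (ENNReal.toReal_mono
    (ENNReal.mul_ne_top (ENNReal.inv_ne_top.2 hB0) hI) ?_)
  refine (enorm_integral_le_lintegral_enorm _).trans ?_
  rw [lintegral_smul_measure, Measure.restrict_apply_univ, Measure.addHaar_ball_center, smul_eq_mul]
  exact mul_le_mul_right ((setLIntegral_le_lintegral _ _).trans hf) _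

theorem totallyBounded_range_setAverage_ball {ι : Type*} {f : ι → E → F} [NormedSpace ℝ F]
    [ProperSpace F] (hδ : 0 < δ) {I : ℝ≥0∞} (hI : I ≠ ∞)
    (hf : ∀ i, ∫⁻ x, ‖f i x‖ₑ ∂μ ≤ I) (Z : Finset E) :
    TotallyBounded (range fun i (z : Z) => ⨍ y in Metric.ball (z : E) δ, f i y ∂μ) := by
  have hbdd : Bornology.IsBounded
      (range fun i (z : Z) => ⨍ y in Metric.ball (z : E) δ, f i y ∂μ) := by
    refine isBounded_iff_forall_norm_le.2 ⟨((μ (Metric.ball 0 δ))⁻¹ * I).toReal, ?_⟩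
    rintro _ ⟨i, rfl⟩
    exact (pi_norm_le_iff_of_nonneg ENNReal.toReal_nonneg).2
      fun z => norm_setAverage_ball_le hδ hI (hf i) z
  exact hbdd.isCompact_closure.totallyBounded.subset subset_closure

variable [NormedSpace ℝ E] [FiniteDimensional ℝ E]

theorem aestronglyMeasurable_add_sub (hf : AEStronglyMeasurable f μ) (B : Set E) :
    AEStronglyMeasurable (fun z : E × E => f (z.1 + z.2) - f z.1) (μ.prod (μ.restrict B)) := by
  have hac : μ.prod (μ.restrict B) ≪ μ.prod μ :=
    .prod .rfl Measure.restrict_le_self.absolutelyContinuous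
  have hshift : AEStronglyMeasurable (fun z : E × E => f (z.1 + z.2)) (μ.prod μ) :=
    hf.comp_snd.comp_measurePreserving (measurePreserving_prod_add μ μ)
  exact (hshift.sub hf.comp_fst).mono_ac hac

theorem aemeasurable_localOscillation (hf : AEStronglyMeasurable f μ) :
    AEMeasurable (localOscillation μ f δ) μ :=
  (aestronglyMeasurable_add_sub hf _).enorm.lintegral_prod_right'.const_mul _

theorem lintegral_localOscillation_le (hf : AEStronglyMeasurable f μ) (hδ : 0 < δ) {κ : ℝ≥0∞}
    (hκ : ∀ h, ‖h‖ < 2 * δ → ∫⁻ x, ‖f (x + h) - f x‖ₑ ∂μ ≤ κ) :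
    ∫⁻ x, localOscillation μ f δ x ∂μ ≤ 2 ^ finrank ℝ E * κ := by
  have hB0 : μ (Metric.ball 0 δ) ≠ 0 := (Metric.measure_ball_pos μ _ hδ).ne'
  have hBtop : μ (Metric.ball 0 δ) ≠ ∞ := measure_ball_lt_top.ne
  simp only [localOscillation]
  rw [lintegral_const_mul' _ _ (ENNReal.inv_ne_top.2 hB0),
    lintegral_lintegral_swap (aestronglyMeasurable_add_sub hf _).enorm]
  calc (μ (Metric.ball 0 δ))⁻¹ *
        ∫⁻ h in Metric.ball 0 (2 * δ), ∫⁻ x, ‖f (x + h) - f x‖ₑ ∂μ ∂μ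
      ≤ (μ (Metric.ball 0 δ))⁻¹ * ∫⁻ _ in Metric.ball (0 : E) (2 * δ), κ ∂μ := by
        refine mul_le_mul_right ?_ _
        exact setLIntegral_mono measurable_const fun h hh => hκ h (mem_ball_zero_iff.1 hh)
    _ = (μ (Metric.ball 0 δ))⁻¹ * μ (Metric.ball 0 δ) * (2 ^ finrank ℝ E * κ) := by
        rw [setLIntegral_const, Measure.addHaar_ball_mul_of_pos _ _ two_pos,
          ENNReal.ofReal_pow zero_le_two, ENNReal.ofReal_ofNat]
        ring
    _ = 2 ^ finrank ℝ E * κ := by rw [ENNReal.inv_mul_cancel hB0 hBtop, one_mul]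

variable [NormedSpace ℝ F]

theorem enorm_sub_average_le {α : Type*} [MeasurableSpace α] {μ : Measure α} [IsFiniteMeasure μ]
    [NeZero μ] [CompleteSpace F] {f : α → F} (hf : Integrable f μ) (c : F) :
    ‖c - ⨍ y, f y ∂μ‖ₑ ≤ ⨍⁻ y, ‖c - f y‖ₑ ∂μ := by
  have hsub : c - ⨍ y, f y ∂μ = ⨍ y, (c - f y) ∂μ := by
    conv_lhs => rw [← average_const μ c]
    exact (integral_sub (integrable_const c) hf.to_average).symm
  rw [hsub]
  exact enorm_integral_le_lintegral_enorm _

theorem enorm_sub_setAverage_ball_le [CompleteSpace F] (hf : Integrable f μ) {x z : E}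
    (hx : x ∈ Metric.ball z δ) :
    ‖f x - ⨍ y in Metric.ball z δ, f y ∂μ‖ₑ ≤ localOscillation μ f δ x := by
  have hB0 : μ (Metric.ball z δ) ≠ 0 :=
    (Metric.isOpen_ball.measure_pos μ ⟨x, hx⟩).ne'
  have : NeZero (μ.restrict (Metric.ball z δ)) := ⟨by simpa using hB0⟩
  have : IsFiniteMeasure (μ.restrict (Metric.ball z δ)) := ⟨by simpa using measure_ball_lt_top⟩
  exact (enorm_sub_average_le hf.integrableOn _).trans (laverage_enorm_sub_le_localOscillation f hx)

theorem enorm_sub_le_localOscillation_add [CompleteSpace F] (hf : Integrable f μ)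
    (hg : Integrable g μ) {x z : E} (hx : x ∈ Metric.ball z δ) :
    ‖f x - g x‖ₑ ≤ localOscillation μ f δ x + (localOscillation μ g δ x +
      ‖(⨍ y in Metric.ball z δ, f y ∂μ) - ⨍ y in Metric.ball z δ, g y ∂μ‖ₑ) := by
  set a := ⨍ y in Metric.ball z δ, f y ∂μ
  set b := ⨍ y in Metric.ball z δ, g y ∂μ
  have ha : ‖f x - a‖ₑ ≤ localOscillation μ f δ x := enorm_sub_setAverage_ball_le hf hx
  have hb : ‖g x - b‖ₑ ≤ localOscillation μ g δ x := enorm_sub_setAverage_ball_le hg hx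
  calc ‖f x - g x‖ₑ = ‖(f x - a) + ((a - b) - (g x - b))‖ₑ := by congr 1; abel
    _ ≤ ‖f x - a‖ₑ + ‖(a - b) - (g x - b)‖ₑ := enorm_add_le _ _
    _ ≤ ‖f x - a‖ₑ + (‖a - b‖ₑ + ‖g x - b‖ₑ) := by gcongr; exact enorm_sub_le
    _ ≤ localOscillation μ f δ x + (localOscillation μ g δ x + ‖a - b‖ₑ) := by
        rw [add_comm ‖a - b‖ₑ]
        gcongr

theorem lintegral_enorm_sub_le_of_setAverage_ball [CompleteSpace F] (hf : Integrable f μ)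
    (hg : Integrable g μ) (hδ : 0 < δ) {S Z : Set E} (hfS : Function.support f ⊆ S)
    (hgS : Function.support g ⊆ S) (hSZ : S ⊆ ⋃ z ∈ Z, Metric.ball z δ) {κ r : ℝ≥0∞}
    (hfκ : ∀ h, ‖h‖ < 2 * δ → ∫⁻ x, ‖f (x + h) - f x‖ₑ ∂μ ≤ κ)
    (hgκ : ∀ h, ‖h‖ < 2 * δ → ∫⁻ x, ‖g (x + h) - g x‖ₑ ∂μ ≤ κ)
    (hr : ∀ z ∈ Z,
      ‖(⨍ y in Metric.ball z δ, f y ∂μ) - ⨍ y in Metric.ball z δ, g y ∂μ‖ₑ ≤ r) :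
    ∫⁻ x, ‖f x - g x‖ₑ ∂μ ≤ 2 ^ finrank ℝ E * κ + (2 ^ finrank ℝ E * κ + r * μ S) := by
  have hpt : ∀ x, ‖f x - g x‖ₑ ≤
      localOscillation μ f δ x + (localOscillation μ g δ x + S.indicator (fun _ => r) x) := by
    intro x
    by_cases hx : x ∈ S
    · obtain ⟨z, hz, hxz⟩ := mem_iUnion₂.1 (hSZ hx)
      rw [indicator_of_mem hx]
      refine (enorm_sub_le_localOscillation_add hf hg hxz).trans ?_
      gcongr
      exact hr z hz
    · simp [Function.notMem_support.1 (notMem_subset hfS hx),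
        Function.notMem_support.1 (notMem_subset hgS hx)]
  refine (lintegral_mono hpt).trans ?_
  rw [lintegral_add_left' (aemeasurable_localOscillation hf.1),
    lintegral_add_left' (aemeasurable_localOscillation hg.1)]
  gcongr
  · exact lintegral_localOscillation_le hf.1 hδ hfκ
  · exact lintegral_localOscillation_le hg.1 hδ hgκ
  · exact lintegral_indicator_const_le S r

/-- The Kolmogorov-Riesz criterion in `L¹`. -/
theorem totallyBounded_range_toLp_one {ι : Type*} [ProperSpace F] {f : ι → E → F}
    (hf : ∀ i, MemLp (f i) 1 μ) {S : Set E} (hS : Bornology.IsBounded S)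
    (hfS : ∀ i, Function.support (f i) ⊆ S) {I : ℝ≥0∞} (hI : I ≠ ∞)
    (hfI : ∀ i, ∫⁻ x, ‖f i x‖ₑ ∂μ ≤ I)
    (htrans : ∀ κ : ℝ, 0 < κ → ∃ δ > 0, ∀ i h, ‖h‖ < δ →
      ∫⁻ x, ‖f i (x + h) - f i x‖ₑ ∂μ ≤ ENNReal.ofReal κ) :
    TotallyBounded (range fun i => (hf i).toLp (f i)) := by
  refine totallyBounded_range_iff.2 fun ε hε => ?_
  have hSμ : μ S ≠ ∞ := hS.measure_lt_top.ne
  obtain ⟨δ, hδ, htransδ⟩ := htrans (ε / (4 * 2 ^ finrank ℝ E)) (by positivity)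
  obtain ⟨Z, hZ, hSZ⟩ := Metric.totallyBounded_iff.1
    (hS.isCompact_closure.totallyBounded.subset subset_closure)
    (δ / 2) (half_pos hδ)
  lift Z to Finset E using hZ
  obtain ⟨t, ht, hcover⟩ := totallyBounded_range_iff.1
    (totallyBounded_range_setAverage_ball (half_pos hδ) hI hfI Z)
    (ε / (2 * (μ.real S + 1))) (by positivity)
  refine ⟨t, ht, fun i => ?_⟩
  obtain ⟨j, hj, hij⟩ := hcover i
  refine ⟨j, hj, ?_⟩
  have hosc : ∀ i h, ‖h‖ < 2 * (δ / 2) → ∫⁻ x, ‖f i (x + h) - f i x‖ₑ ∂μ ≤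
      ENNReal.ofReal (ε / (4 * 2 ^ finrank ℝ E)) := fun i h hh =>
    htransδ i h (by linarith)
  have havg : ∀ z ∈ (Z : Set E), ‖(⨍ y in Metric.ball z (δ / 2), f i y ∂μ) -
      ⨍ y in Metric.ball z (δ / 2), f j y ∂μ‖ₑ ≤
        ENNReal.ofReal (ε / (2 * (μ.real S + 1))) := fun z hz => by
    rw [← ofReal_norm, ← dist_eq_norm]
    exact ENNReal.ofReal_le_ofReal ((dist_le_pi_dist _ _ (⟨z, hz⟩ : Z)).trans hij.le)
  rw [← edist_lt_ofReal, Lp.edist_toLp_toLp, eLpNorm_one_eq_lintegral_enorm]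
  refine (lintegral_enorm_sub_le_of_setAverage_ball (memLp_one_iff_integrable.1 (hf i))
    (memLp_one_iff_integrable.1 (hf j)) (half_pos hδ) (hfS i) (hfS j) hSZ (hosc i) (hosc j)
    havg).trans_lt ?_
  have htwo : (2 : ℝ≥0∞) ^ finrank ℝ E = ENNReal.ofReal (2 ^ finrank ℝ E) := by
    rw [ENNReal.ofReal_pow zero_le_two, ENNReal.ofReal_ofNat]
  rw [htwo, ← ofReal_measureReal hSμ, ← ENNReal.ofReal_mul (by positivity),
    ← ENNReal.ofReal_mul (by positivity), ← ENNReal.ofReal_add (by positivity) (by positivity),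
    ← ENNReal.ofReal_add (by positivity) (by positivity), ENNReal.ofReal_lt_ofReal_iff hε]
  field_simp
  nlinarith [measureReal_nonneg (μ := μ) (s := S)]

end Kolmogorov

section SignedPower

variable {α : Type*} [MeasurableSpace α] {μ : Measure α} {p : ℝ≥0∞}

theorem eLpNorm_sub_rpow_le_signedPow (hp : 1 ≤ p) (hp' : p ≠ ∞) (f g : α → ℝ) :
    eLpNorm (f - g) p μ ^ p.toReal ≤ 2 ^ p.toReal *
      eLpNorm (signedPow p.toReal ∘ f - signedPow p.toReal ∘ g) 1 μ := by
  have hr : 1 ≤ p.toReal := ENNReal.toReal_one ▸ ENNReal.toReal_mono hp' hp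
  have hr0 : 0 < p.toReal := by linarith
  have h2 : (2 : ℝ≥0∞) ^ p.toReal = ENNReal.ofReal (2 ^ p.toReal) := by
    rw [← ENNReal.ofReal_rpow_of_nonneg zero_le_two hr0.le, ENNReal.ofReal_ofNat]
  rw [eLpNorm_eq_lintegral_rpow_enorm_toReal (zero_lt_one.trans_le hp).ne' hp', one_div,
    ENNReal.rpow_inv_rpow hr0.ne', eLpNorm_one_eq_lintegral_enorm, h2,
    ← lintegral_const_mul' _ _ ENNReal.ofReal_ne_top]
  refine lintegral_mono fun x => ?_
  rw [Real.enorm_eq_ofReal_abs, Real.enorm_eq_ofReal_abs, ← ENNReal.ofReal_mul (by positivity),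
    ENNReal.ofReal_rpow_of_nonneg (abs_nonneg _) hr0.le]
  exact ENNReal.ofReal_le_ofReal (abs_sub_rpow_le_signedPow hr _ _)

theorem totallyBounded_range_toLp_of_signedPow [Fact (1 ≤ p)] (hp : p ≠ ∞) {ι : Type*}
    {f : ι → α → ℝ} (hf : ∀ i, MemLp (f i) p μ)
    (hf' : ∀ i, MemLp (signedPow p.toReal ∘ f i) 1 μ)
    (h : TotallyBounded (range fun i => (hf' i).toLp (signedPow p.toReal ∘ f i))) :
    TotallyBounded (range fun i => (hf i).toLp (f i)) := by
  have hp1 : 1 ≤ p := Fact.out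
  have hr : 0 < p.toReal := ENNReal.toReal_pos (zero_lt_one.trans_le hp1).ne' hp
  refine totallyBounded_range_iff.2 fun ε hε => ?_
  obtain ⟨t, ht, hcover⟩ := totallyBounded_range_iff.1 h ((ε / 2) ^ p.toReal) (by positivity)
  refine ⟨t, ht, fun i => ?_⟩
  obtain ⟨j, hj, hij⟩ := hcover i
  refine ⟨j, hj, ?_⟩
  rw [← edist_lt_ofReal, Lp.edist_toLp_toLp] at hij ⊢
  rw [← ENNReal.rpow_lt_rpow_iff hr]
  calc eLpNorm (f i - f j) p μ ^ p.toReal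
      ≤ 2 ^ p.toReal * eLpNorm (signedPow p.toReal ∘ f i - signedPow p.toReal ∘ f j) 1 μ :=
        eLpNorm_sub_rpow_le_signedPow hp1 hp _ _
    _ < 2 ^ p.toReal * ENNReal.ofReal ((ε / 2) ^ p.toReal) := by
        refine ENNReal.mul_lt_mul_right ?_ ?_ hij
        · simp
        · simp
    _ = ENNReal.ofReal ε ^ p.toReal := by
        rw [← ENNReal.ofReal_rpow_of_pos (half_pos hε), ← ENNReal.mul_rpow_of_nonneg _ _ hr.le,
          ← ENNReal.ofReal_ofNat, ← ENNReal.ofReal_mul zero_le_two, mul_div_cancel₀ _ two_ne_zero]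

end SignedPower

theorem LpToLpRestrictCLM_toLp {α F : Type*} [MeasurableSpace α] {μ : Measure α} {p : ℝ≥0∞}
    [Fact (1 ≤ p)] [NormedAddCommGroup F] [NormedSpace ℝ F] {f : α → F} (hf : MemLp f p μ)
    (s : Set α) : LpToLpRestrictCLM α F ℝ μ p s (hf.toLp f) = (hf.restrict s).toLp f :=
  MemLp.toLp_congr ((Lp.memLp _).restrict s) _ (ae_restrict_of_ae hf.coeFn_toLp)

namespace SpaceDiscretisation

variable {d : ℕ} {Ω : Set (EuclideanSpace ℝ (Fin d))} {ι : Type*} (D : ι → SpaceDiscretisation Ω)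
  (u : ι → EuclideanSpace ℝ (Fin d) → ℝ)

theorem totallyBounded_range_toLp_one_stepFun (hd : 1 ≤ d) (hb : Bornology.IsBounded Ω) {V : ℝ}
    (hV : ∀ i, (D i).discreteNorm 1 (u i) ≤ V) :
    TotallyBounded
      (range fun i => ((D i).memLp_stepFun (u i) hb 1).toLp ((D i).stepFun (u i))) := by
  obtain ⟨R, hR, hΩ⟩ := hb.subset_ball_lt 0 0
  refine totallyBounded_range_toLp_one _ hb
    (fun i x hx => by_contra fun hxΩ => hx ((D i).stepFun_of_notMem_domain (u i) hxΩ))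
    (I := ENNReal.ofReal (2 * R * V)) ENNReal.ofReal_ne_top (fun i => ?_)
    fun κ hκ => ⟨κ / (|V| + 1), by positivity, fun i h hh => ?_⟩
  · rw [(D i).lintegral_enorm_stepFun (u i) hb]
    refine ENNReal.ofReal_le_ofReal (((D i).sum_volume_mul_abs_le (u i) hd hΩ hR.le).trans ?_)
    gcongr
    exact hV i
  · refine ((D i).lintegral_stepFun_add_sub_le (u i) hb h).trans (ENNReal.ofReal_le_ofReal ?_)
    calc ‖h‖ * (D i).discreteNorm 1 (u i) ≤ ‖h‖ * (|V| + 1) := by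
          gcongr
          linarith [hV i, le_abs_self V]
      _ ≤ κ := ((lt_div_iff₀ (by positivity)).1 hh).le

theorem totallyBounded_range_toLp_stepFun (hd : 1 ≤ d) (hb : Bornology.IsBounded Ω) {p : ℝ≥0∞}
    [Fact (1 ≤ p)] (hp : p ≠ ∞) {η : ℝ} (hη : 0 < η) (hratio : ∀ i, (D i).RatioBound η) {C : ℝ}
    (hC : ∀ i, (D i).discreteNorm p.toReal (u i) ≤ C) :
    TotallyBounded
      (range fun i => ((D i).memLp_stepFun (u i) hb p).toLp ((D i).stepFun (u i))) := by
  have hr : 1 ≤ p.toReal := ENNReal.toReal_one ▸ ENNReal.toReal_mono hp Fact.out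
  obtain ⟨V, hV⟩ := exists_forall_discreteNorm_one_signedPow_comp_le hd hb hr hη C
  have hcomp i := (D i).stepFun_comp (u i) (signedPow_zero p.toReal)
  refine totallyBounded_range_toLp_of_signedPow hp _
    (fun i => hcomp i ▸ (D i).memLp_stepFun _ hb 1) ?_
  simp only [← hcomp]
  exact totallyBounded_range_toLp_one_stepFun D _ hd hb
    fun i => hV (D i) (hratio i) (u i) (hC i)

end SpaceDiscretisation

theorem lemma5p6_general {d : ℕ} (hd : 1 ≤ d) (p : ℝ≥0∞) [Fact (1 ≤ p)] (hp : p ≠ ∞)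
    (Ω : Set (EuclideanSpace ℝ (Fin d))) (hbdd : Bornology.IsBounded Ω)
    {ι : Type*} (D : ι → SpaceDiscretisation Ω)
    (η : ℝ) (hη : 0 < η) (hratio : ∀ i, (D i).RatioBound η)
    (u : ι → EuclideanSpace ℝ (Fin d) → ℝ) (hu : ∀ i, (D i).PiecewiseConstant (u i))
    (C : ℝ) (hC : ∀ i, (D i).discreteNorm p.toReal (u i) ≤ C) :
    (∃ h : ∀ i, MemLp (u i) p (volume.restrict Ω),
      IsCompact (closure (Set.range fun i => (h i).toLp (u i)))) ∧
    (∃ h : ∀ i, MemLp (Ω.indicator (u i)) p volume,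
      IsCompact (closure (Set.range fun i => (h i).toLp (Ω.indicator (u i))))) := by
  have hv i : MemLp ((D i).stepFun (u i)) p := (D i).memLp_stepFun (u i) hbdd p
  have hcpt : IsCompact (closure (range fun i => (hv i).toLp ((D i).stepFun (u i)))) :=
    (SpaceDiscretisation.totallyBounded_range_toLp_stepFun D u hd hbdd hp hη hratio
      hC).closure.isCompact_of_isClosed isClosed_closure
  have hres i : MemLp (u i) p (volume.restrict Ω) :=
    ((hv i).restrict Ω).ae_eq (hu i).ae_restrict_eq_stepFun.symm
  have hind i : MemLp (Ω.indicator (u i)) p := (hv i).ae_eq (hu i).indicator_ae_eq_stepFun.symm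
  refine ⟨⟨hres, ?_⟩, hind, ?_⟩
  · refine (hcpt.image (LpToLpRestrictCLM _ ℝ ℝ volume p Ω).continuous).closure_of_subset ?_
    rintro _ ⟨i, rfl⟩
    refine ⟨_, subset_closure ⟨i, rfl⟩, ?_⟩
    exact (LpToLpRestrictCLM_toLp (hv i) Ω).trans
      (MemLp.toLp_congr _ _ (hu i).ae_restrict_eq_stepFun.symm)
  · simpa only [(hind _).toLp_congr (hv _) (hu _).indicator_ae_eq_stepFun] using hcpt

theorem lemma5p6 {d : ℕ} (hd : 1 ≤ d) (p : ℝ≥0∞) [Fact (1 ≤ p)] (hp : p ≠ ∞)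
    (Ω : Set (EuclideanSpace ℝ (Fin d))) (hopen : IsOpen Ω) (hbdd : Bornology.IsBounded Ω)
    (hconn : IsConnected Ω) (hpoly : IsPolyhedral Ω)
    {ι : Type*} (D : ι → SpaceDiscretisation Ω)
    (η : ℝ) (hη : 0 < η) (hratio : ∀ i, (D i).RatioBound η)
    (u : ι → EuclideanSpace ℝ (Fin d) → ℝ) (hu : ∀ i, (D i).PiecewiseConstant (u i))
    (C : ℝ) (hC : ∀ i, (D i).discreteNorm p.toReal (u i) ≤ C) :
    (∃ h : ∀ i, MemLp (u i) p (volume.restrict Ω),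
      IsCompact (closure (Set.range fun i => (h i).toLp (u i)))) ∧
    (∃ h : ∀ i, MemLp (Ω.indicator (u i)) p volume,
      IsCompact (closure (Set.range fun i => (h i).toLp (Ω.indicator (u i))))) :=
  lemma5p6_general hd p hp Ω hbdd D η hη hratio u hu C hC
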